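/- **Theorem.** Let $e_1<e_2<e_3<e_4$ be real numbers, let $\mu=(\mu_1,\mu_2,\mu_3,\mu_4)\in\{0,1\}^4$ be any of the 16 parity classes, and put $\tilde\gamma_m=\tfrac12+\mu_m$. For $i<j$ let $w_{ij}=\mu_i+\mu_j+2\mu_i\mu_j$, let $\{k,m\}$ denote the complement of $\{i,j\}$ in $\{1,2,3,4\}$, and set $$u_0=\sum_{i<j}w_{ij},\qquad u_1=-\sum_{i<j}w_{ij}(e_k+e_m),\qquad u_2=\sum_{i<j}w_{ij}\,e_ke_m .$$ Let $S=S_d^\mu$ be a real polynomial of degree exactly $d\ge 0$ (a Heine–Stieltjes polynomial) that satisfies, for some real spectral parameters $E,\lambda_1,\lambda_2$, the transformed generalised Lamé equation $$S''(z)+\sum_{m=1}^4\frac{\tilde\gamma_m}{z-e_m}\,S'(z)+\frac{(u_0-E)z^2+(u_1+\lambda_1)z+(u_2-\lambda_2)}{4\prod_{m=1}^4(z-e_m)}\,S(z)=0\qquad(z\in\mathbb R\setminus\{e_1,\dots,e_4\}).$$ With $c$ the leading coefficient of $S$ and $z_1,z_2,\dots$ its real zeros, listed with multiplicity, put $$\Phi^\mu(x)=(-1)^d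 c^3\prod_{k}\ \sum_{i=1}^4 x_i^2\prod_{l\ne i}(z_k-e_l),\qquad \Psi_D^\mu(x)=x_1^{\mu_1}x_2^{\mu_2}x_3^{\mu_3}x_4^{\mu_4}\,\Phi^\mu(x),\qquad D=2d+\sum_{i=1}^4\mu_i .$$ Then: 1. $\Phi^\mu$ is a homogeneous polynomial of degree $2d$, and it is the product $S(s_1)S(s_2)S(s_3)$ rewritten in Cartesian coordinates: $\Phi^\mu(x)=S(s_1)S(s_2)S(s_3)$ whenever $e_j\le s_j\le e_{j+1}$ for $j=1,2,3$ and $x_i^2=\prod_{j=1}^3(s_j-e_i)\big/\prod_{k\ne i}(e_k-e_i)$ for $i=1,\dots,4$ (ellipsoidal coordinates on $S^3$). 2. $\Psi_D^\mu$ is a homogeneous harmonic polynomial of degree $D$ on $\mathbb R^4$: $\sum_{i=1}^4\partial_i^2\Psi_D^\mu=0$. 3. The restriction of $\Psi_D^\mu$ to the unit sphere $S^3\subset\mathbb R^4$ is not identically zero and is an eigenfunction of the Laplace–Beltrami operator, $-\Delta_{S^3}\Psi_D^\mu=E\,\Psi_D^\mu$; equivalently, it solves the Schrödinger equation $-\hbar^2\Delta_{S^3}\Psi_D^\mu=\tilde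 E\,\Psi_D^\mu$ with $\tilde E=\hbar^2E$. The eigenvalue is the parameter $E$ of the differential equation, and $E=D(D+2)$. 4. The same equation holds in ellipsoidal coordinates: for $e_j<s_j<e_{j+1}$ $(j=1,2,3)$ and any choice of the signs of the $x_i$, the function $\psi(s)=\Psi_D^\mu(x(s))$ satisfies $$-\hbar^2\,\frac1{\sqrt g}\sum_{j=1}^3\frac{\partial}{\partial s_j}\Big(\frac{\sqrt g}{g_{jj}}\,\frac{\partial\psi}{\partial s_j}\Big)=\hbar^2E\,\psi,\qquad g_{jj}=-\frac{\prod_{k\ne j}(s_j-s_k)}{4\prod_{i=1}^4(s_j-e_i)},\quad g=g_{11}g_{22}g_{33}.$$ -/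

import Mathlib

open Polynomial

noncomputable section

namespace S3Ellipsoidal

/-! ### The transformed generalised Lamé equation -/

/-- The exponent parameter `3/2` at an odd axis (`μ m = 1`) and `1/2` at an even axis. -/
def gammaTilde (μ : Fin 4 → Fin 2) (m : Fin 4) : ℝ :=
  if μ m = 1 then 3 / 2 else 1 / 2

/-- The weight of a pair of axes: `4` if both are odd, `1` if exactly one is odd, `0` if both are
even. -/
def pairWeight (μ : Fin 4 → Fin 2) (i j : Fin 4) : ℝ :=
  if μ i = 1 ∧ μ j = 1 then 4 else if μ i = 1 ∨ μ j = 1 then 1 else 0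

/-- The coefficient shift `u₀`, equal to `0, 3, 8, 15, 24` for `0, 1, 2, 3, 4` odd axes. -/
def u0 (μ : Fin 4 → Fin 2) : ℝ :=
  ∑ i, ∑ j ∈ Finset.Ioi i, pairWeight μ i j

/-- The coefficient shift `u₁`: each pair `i < j` contributes `-w (e k + e m)`, where `w` is the
weight of the pair and `k, m` are the two remaining indices. -/
def u1 (e : Fin 4 → ℝ) (μ : Fin 4 → Fin 2) : ℝ :=
  -∑ i, ∑ j ∈ Finset.Ioi i, pairWeight μ i j * ∑ k ∈ ({i, j} : Finset (Fin 4))ᶜ, e k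

/-- The coefficient shift `u₂`: each pair `i < j` contributes `w e k e m`, where `w` is the
weight of the pair and `k, m` are the two remaining indices. -/
def u2 (e : Fin 4 → ℝ) (μ : Fin 4 → Fin 2) : ℝ :=
  ∑ i, ∑ j ∈ Finset.Ioi i, pairWeight μ i j * ∏ k ∈ ({i, j} : Finset (Fin 4))ᶜ, e k

/-- `S` is a polynomial solution of degree `d`, in the symmetry class `μ`, of the transformed
generalised Lamé equation with semi-major axes `e` and spectral parameters `E`, `l₁`, `l₂`. -/
structure IsHeineStieltjes (e : Fin 4 → ℝ) (μ : Fin 4 → Fin 2) (d : ℕ) (E l₁ l₂ : ℝ)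
    (S : ℝ[X]) : Prop where
  degree_eq : S.degree = (d : WithBot ℕ)
  ode : ∀ z : ℝ, (∀ i, z ≠ e i) →
    (derivative (derivative S)).eval z
      + (∑ m, gammaTilde μ m / (z - e m)) * (derivative S).eval z
      + ((u0 μ - E) * z ^ 2 + (u1 e μ + l₁) * z + (u2 e μ - l₂)) / (4 * ∏ m, (z - e m))
        * S.eval z = 0

/-! ### Ellipsoidal coordinates and the wave functions in Cartesian coordinates -/

/-- The squares `x i ^ 2` of the Cartesian coordinates in terms of ellipsoidal ones. -/
def cartesianSq (e : Fin 4 → ℝ) (s : Fin 3 → ℝ) (i : Fin 4) : ℝ :=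
  (∏ j, (s j - e i)) / ∏ k ∈ Finset.univ.erase i, (e k - e i)

/-- `s` are ellipsoidal coordinates of the point `x` of the unit sphere. -/
def IsEllipsoidalCoord (e : Fin 4 → ℝ) (s : Fin 3 → ℝ) (x : Fin 4 → ℝ) : Prop :=
  (∀ j : Fin 3, e j.castSucc ≤ s j ∧ s j ≤ e j.succ) ∧ ∀ i, x i ^ 2 = cartesianSq e s i

/-- The quadratic form `(∏ i, (z - e i)) * ∑ i, x i ^ 2 / (z - e i)`, with denominators
cleared. -/
def quadForm (e : Fin 4 → ℝ) (z : ℝ) : MvPolynomial (Fin 4) ℝ :=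
  ∑ i, MvPolynomial.C (∏ k ∈ Finset.univ.erase i, (z - e k)) * MvPolynomial.X i ^ 2

/-- The product over the zeros `z` of `S` of the quadratic forms above. The constant in front makes
this the product of the three values of `S` at the ellipsoidal coordinates, and not just a multiple
of it. -/
def Phi (e : Fin 4 → ℝ) (S : ℝ[X]) : MvPolynomial (Fin 4) ℝ :=
  MvPolynomial.C ((-1) ^ S.natDegree * S.leadingCoeff ^ 3) * (S.roots.map (quadForm e)).prod

/-- The wave function of the symmetry class `μ` attached to `S`. -/
def Psi (e : Fin 4 → ℝ) (μ : Fin 4 → Fin 2) (S : ℝ[X]) : MvPolynomial (Fin 4) ℝ :=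
  (∏ i, MvPolynomial.X i ^ (μ i : ℕ)) * Phi e S

/-! ### The operators -/

/-- The unit sphere in Euclidean space of dimension four. -/
abbrev S3 : Type := Metric.sphere (0 : EuclideanSpace ℝ (Fin 4)) 1

/-- The extension of a function on the sphere that is constant along rays from the origin. -/
def radialExtension (f : S3 → ℝ) (y : EuclideanSpace ℝ (Fin 4)) : ℝ :=
  if h : y = 0 then 0
  else f ⟨‖y‖⁻¹ • y, by
    rw [mem_sphere_zero_iff_norm, norm_smul, norm_inv, norm_norm,
      inv_mul_cancel₀ (norm_ne_zero_iff.mpr h)]⟩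

/-- The Laplace–Beltrami operator of the unit sphere: in the decomposition
`∂ᵣ² + (3 / r) ∂ᵣ + r⁻² Δ_S` of the Euclidean Laplacian the first two terms vanish on a function
that does not depend on `r`. -/
def laplaceBeltrami (f : S3 → ℝ) (x : S3) : ℝ :=
  Laplacian.laplacian (radialExtension f) (x : EuclideanSpace ℝ (Fin 4))

/-- The Schrödinger operator `-ℏ² Δ` on functions on the sphere. -/
def schrodinger (ℏ : ℝ) (f : S3 → ℝ) (x : S3) : ℝ := -ℏ ^ 2 * laplaceBeltrami f x

/-- The restriction of a polynomial to the sphere. -/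
def restrictSphere (P : MvPolynomial (Fin 4) ℝ) (x : S3) : ℝ :=
  MvPolynomial.eval (fun i => (x : EuclideanSpace ℝ (Fin 4)) i) P

/-- The diagonal entries of the round metric in ellipsoidal coordinates. -/
def metric (e : Fin 4 → ℝ) (j : Fin 3) (s : Fin 3 → ℝ) : ℝ :=
  -(∏ k ∈ Finset.univ.erase j, (s j - s k)) / (4 * ∏ i, (s j - e i))

/-- The partial derivative with respect to the coordinate `s j`. -/
def partialDeriv (j : Fin 3) (f : (Fin 3 → ℝ) → ℝ) (s : Fin 3 → ℝ) : ℝ :=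
  deriv (fun t => f (Function.update s j t)) (s j)

/-- The Laplace–Beltrami operator `(1 / √g) ∑ ∂ⱼ (√g gʲʲ ∂ⱼ)` in ellipsoidal coordinates. -/
def laplaceBeltramiCoord (e : Fin 4 → ℝ) (f : (Fin 3 → ℝ) → ℝ) (s : Fin 3 → ℝ) : ℝ :=
  1 / √(∏ k, metric e k s) *
    ∑ j, partialDeriv j
      (fun t => √(∏ k, metric e k t) * (metric e j t)⁻¹ * partialDeriv j f t) s

/-- The point with ellipsoidal coordinates `s` in the orthant given by the signs `ε`. -/
def ellipsoidalPoint (e : Fin 4 → ℝ) (ε : Fin 4 → ℤˣ) (s : Fin 3 → ℝ) (i : Fin 4) : ℝ :=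
  ((ε i : ℤ) : ℝ) * √(cartesianSq e s i)

end S3Ellipsoidal

end

/-!
The proof rests on the electrostatic description of the zeros of `S`. With denominators cleared the
equation becomes `A S'' + B S' + V S = 0` with polynomial coefficients. Its indicial exponents are
`0` and `1 - γ̃ ∈ {1/2, -1/2}` at the points `eᵢ`, and `0` and `1` elsewhere, so every zero of `S` is
simple and different from all `eᵢ`; the next Taylor coefficient at a zero `z` gives Niven's equation
`2 ∑ 1 / (z - w) + ∑ γ̃ᵢ / (z - eᵢ) = 0`, the sum being over the other zeros `w`
(`Polynomial.sum_inv_sub_roots_of_ode`). Over `ℂ` this equation fails at a zero whose imaginary part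
is nonzero and largest in absolute value, since all the terms then pull to the same side. Hence all
zeros are real (`Polynomial.splits_of_ode`), and `Φ`, built from the real zeros, has the full
degree `2 d`.

Up to a constant, `Φ` is the product of the confocal forms `Θ_z = ∑ xᵢ² / (z - eᵢ)` over the zeros
`z`. Because of the partial fraction identity
`∇Θ_z · ∇Θ_w = 4 (Θ_w - Θ_z) / (z - w)`, the Laplacian of `x ^ μ ∏ Θ_z` is a combination of the
products with one factor `Θ_z` omitted, and the coefficients are four times the left-hand sides of
Niven's equations (`MvPolynomial.sum_pderiv_pderiv_prod_confocal`). So `Ψ` is harmonic. Lagrange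
interpolation at the `eᵢ` turns each quadratic form into `∏ (z - sⱼ)` in ellipsoidal coordinates,
which makes `Φ` the product of the three values of `S`.

A homogeneous harmonic polynomial of degree `D` restricts to an eigenfunction on the sphere with
eigenvalue `D (D + 2)`; this is a computation with the Laplacian of `‖y‖⁻ᴰ Ψ(y)`
(`S3Ellipsoidal.laplacian_normPowMul`). The coefficient of highest degree in the equation for `S`
shows that `E` is this number (`S3Ellipsoidal.IsHeineStieltjes.energy_eq`).

In ellipsoidal coordinates the operator is separated directly. The factor `√g / gⱼⱼ` depends on `sⱼ`
like the square root of `∏ (sⱼ - eᵢ)`, so each summand of the operator reduces to the Lamé equation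
in one variable and multiplies `Ψ` by the spectral polynomial at `sⱼ` over `∏ (sⱼ - sₖ)`. The sum of
these is a divided difference that retains only the quadratic coefficient `-E`
(`S3Ellipsoidal.laplaceBeltramiCoord_Psi`).
-/

/-! ### Zeros of polynomial solutions of a Fuchsian equation -/

namespace Polynomial

variable {K ι : Type*} [Field K] [Fintype ι]

/-- The polynomial `∏ (X - eᵢ)`, the coefficient of the second derivative in the Lamé equation
with denominators cleared. -/
noncomputable def lameLead (e : ι → K) : K[X] := ∏ i, (X - C (e i))

lemma eval_lameLead (e : ι → K) (z : K) : (lameLead e).eval z = ∏ i, (z - e i) := by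
  simp [lameLead, eval_prod]

variable [DecidableEq ι]

/-- The polynomial `∑ γᵢ ∏_{l ≠ i} (X - eₗ)`, the coefficient of the first derivative in the Lamé
equation with denominators cleared. -/
noncomputable def lameSub (e γ : ι → K) : K[X] :=
  ∑ i, C (γ i) * ∏ l ∈ Finset.univ.erase i, (X - C (e l))

lemma eval_lameSub (e γ : ι → K) (z : K) (hz : ∀ i, z ≠ e i) :
    (lameSub e γ).eval z = (lameLead e).eval z * ∑ i, γ i / (z - e i) := by
  rw [eval_lameLead, lameSub, eval_finsetSum, Finset.mul_sum]
  refine Finset.sum_congr rfl fun i _ => ?_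
  have : z - e i ≠ 0 := sub_ne_zero.mpr (hz i)
  rw [← Finset.mul_prod_erase _ _ (Finset.mem_univ i)]
  simp only [eval_mul, eval_C, eval_prod, eval_sub, eval_X]
  field_simp

/-- At a node the indicial exponents of the equation are `0` and `1 - γ`, at any other point they
are `0` and `1`. Hence a polynomial solution has only simple zeros, none of them at a node, and
the first nonvanishing Taylor coefficient of the equation at a zero relates the values there of
the cofactor and its derivative. -/
theorem exists_cofactor_of_ode [CharZero K] {e γ : ι → K} (he : Function.Injective e)
    (hγ : ∀ i (k : ℕ), 1 ≤ k → (k : K) - 1 + γ i ≠ 0) {P V : K[X]} (hP : P ≠ 0)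
    (hode : lameLead e * derivative (derivative P) + lameSub e γ * derivative P + V * P = 0)
    {z : K} (hz : P.IsRoot z) :
    (∀ i, z ≠ e i) ∧ ∃ T : K[X], P = (X - C z) * T ∧ T.eval z ≠ 0 ∧
      2 * (lameLead e).eval z * (derivative T).eval z + (lameSub e γ).eval z * T.eval z = 0 := by
  obtain ⟨T, hPT, hT⟩ := exists_eq_pow_rootMultiplicity_mul_and_not_dvd P hP z
  have hk : 1 ≤ P.rootMultiplicity z := (rootMultiplicity_pos hP).mpr hz
  obtain ⟨k, hk'⟩ : ∃ k, P.rootMultiplicity z = k + 1 := ⟨_, (Nat.sub_add_cancel hk).symm⟩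
  rw [hk'] at hPT
  have hTz : T.eval z ≠ 0 := fun h => hT (dvd_iff_isRoot.mpr h)
  have hX : (X - C z : K[X]) ≠ 0 := X_sub_C_ne_zero z
  -- the equation, multiplied by `(X - z) ^ 2` and divided by `(X - z) ^ (k + 1)`
  have key : lameLead e * (((k : K[X]) + 1) * (k : K[X]) * T
        + 2 * ((k : K[X]) + 1) * (X - C z) * derivative T
        + (X - C z) ^ 2 * derivative (derivative T))
      + (X - C z) * (lameSub e γ * (((k : K[X]) + 1) * T + (X - C z) * derivative T))
      + (X - C z) ^ 2 * V * T = 0 := by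
    have h1 : (X - C z) * derivative P
        = (X - C z) ^ (k + 1) * (((k : K[X]) + 1) * T + (X - C z) * derivative T) := by
      rw [hPT]
      simp only [derivative_mul, derivative_X_sub_C_pow, Nat.add_sub_cancel, map_natCast]
      push_cast
      ring
    have h2 : (X - C z) ^ 2 * derivative (derivative P)
        = (X - C z) ^ (k + 1) * (((k : K[X]) + 1) * (k : K[X]) * T
          + 2 * ((k : K[X]) + 1) * (X - C z) * derivative T
          + (X - C z) ^ 2 * derivative (derivative T)) := by
      rw [hPT]
      rcases k with _ | k
      · simp [derivative_mul]
        ring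
      · simp only [derivative_mul, derivative_X_sub_C_pow, Nat.add_sub_cancel, map_natCast,
          derivative_add, derivative_natCast]
        push_cast
        ring
    apply mul_left_cancel₀ (pow_ne_zero (k + 1) hX)
    rw [mul_zero]
    have h3 := congrArg (fun q => (X - C z) ^ 2 * q) hode
    simp only [mul_zero] at h3
    calc _ = lameLead e * ((X - C z) ^ 2 * derivative (derivative P))
          + (X - C z) * (lameSub e γ * ((X - C z) * derivative P)) + (X - C z) ^ 2 * V * P := by
            rw [h1, h2]
            conv_rhs => rw [hPT]
            ring
      _ = 0 := by rw [← h3]; ring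
  have hne : ∀ i, z ≠ e i := by
    rintro i rfl
    set A₁ : K[X] := ∏ l ∈ Finset.univ.erase i, (X - C (e l)) with hA₁
    have hA : lameLead e = (X - C (e i)) * A₁ :=
      (Finset.mul_prod_erase _ _ (Finset.mem_univ i)).symm
    have hA₁z : A₁.eval (e i) ≠ 0 := by
      simp only [hA₁, eval_prod, eval_sub, eval_X, eval_C]
      refine Finset.prod_ne_zero_iff.mpr fun l hl => sub_ne_zero.mpr fun h => ?_
      exact (Finset.ne_of_mem_erase hl) (he h.symm)
    -- only the summand that omits the factor `X - e i` survives at the node `e i`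
    have hB : (lameSub e γ).eval (e i) = γ i * A₁.eval (e i) := by
      rw [lameSub, eval_finsetSum, Finset.sum_eq_single i]
      · simp [hA₁]
      · intro j _ hj
        have : i ∈ Finset.univ.erase j := Finset.mem_erase.mpr ⟨hj.symm, Finset.mem_univ i⟩
        rw [eval_mul, ← Finset.mul_prod_erase _ _ this]
        simp
      · simp
    have key' : A₁ * (((k : K[X]) + 1) * (k : K[X]) * T
          + 2 * ((k : K[X]) + 1) * (X - C (e i)) * derivative T
          + (X - C (e i)) ^ 2 * derivative (derivative T))
        + (lameSub e γ * (((k : K[X]) + 1) * T + (X - C (e i)) * derivative T))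
        + (X - C (e i)) * V * T = 0 := by
      apply mul_left_cancel₀ hX
      rw [mul_zero, ← key, hA]
      ring
    have h0 := congrArg (eval (e i)) key'
    simp only [eval_add, eval_mul, eval_sub, eval_X, eval_C, eval_pow, eval_natCast, eval_one,
      eval_ofNat,
      hB, eval_zero, sub_self] at h0
    have h1 : ((k : K) + 1) * (A₁.eval (e i)) * (T.eval (e i)) * (((k + 1 : ℕ) : K) - 1 + γ i)
        = 0 := by
      push_cast
      rw [← h0]
      ring
    have h2 : ((k : K) + 1) ≠ 0 := by exact_mod_cast Nat.succ_ne_zero k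
    exact mul_ne_zero (mul_ne_zero (mul_ne_zero h2 hA₁z) hTz) (hγ i (k + 1) (by omega)) h1
  have hAz : (lameLead e).eval z ≠ 0 := by
    rw [eval_lameLead]
    exact Finset.prod_ne_zero_iff.mpr fun i _ => sub_ne_zero.mpr (hne i)
  have hk0 : k = 0 := by
    have h0 := congrArg (eval z) key
    simp only [eval_add, eval_mul, eval_sub, eval_X, eval_C, eval_pow, eval_natCast, eval_one,
      eval_ofNat,
      eval_zero, sub_self] at h0
    have h1 : (lameLead e).eval z * (((k + 1 : ℕ) : K) * k * T.eval z) = 0 := by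
      push_cast
      rw [← h0]
      ring
    simpa [hAz, hTz, Nat.cast_add_one_ne_zero k] using h1
  subst hk0
  refine ⟨hne, T, by simpa using hPT, hTz, ?_⟩
  have key' : lameLead e * (2 * derivative T + (X - C z) * derivative (derivative T))
      + lameSub e γ * (T + (X - C z) * derivative T) + (X - C z) * V * T = 0 := by
    apply mul_left_cancel₀ hX
    rw [mul_zero, ← key]
    push_cast
    ring
  have h0 := congrArg (eval z) key'
  simp only [eval_add, eval_mul, eval_sub, eval_X, eval_C, eval_ofNat,
    eval_zero, sub_self] at h0
  rw [← h0]
  ring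

/-- The Stieltjes–Niven equations: the zeros of a polynomial solution are in electrostatic
equilibrium with charges at the nodes. -/
theorem sum_inv_sub_roots_of_ode [CharZero K] {e γ : ι → K} (he : Function.Injective e)
    (hγ : ∀ i (k : ℕ), 1 ≤ k → (k : K) - 1 + γ i ≠ 0) {P V : K[X]} (hP : P ≠ 0)
    (hs : P.Splits)
    (hode : lameLead e * derivative (derivative P) + lameSub e γ * derivative P + V * P = 0)
    {z : K} (hz : z ∈ P.roots) :
    ∃ R : Multiset K, P.roots = z ::ₘ R ∧ z ∉ R ∧
      2 * (R.map fun w => 1 / (z - w)).sum + ∑ i, γ i / (z - e i) = 0 := by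
  obtain ⟨hne, T, hPT, hTz, h⟩ := exists_cofactor_of_ode he hγ hP hode (isRoot_of_mem_roots hz)
  have hTs : T.Splits := hs.of_dvd hP ⟨X - C z, by rw [hPT, mul_comm]⟩
  refine ⟨T.roots, ?_, fun hm => hTz (isRoot_of_mem_roots hm), ?_⟩
  · rw [hPT, roots_mul (hPT ▸ hP), roots_X_sub_C, Multiset.singleton_add]
  · rw [eval_lameSub _ _ _ hne] at h
    have hAz : (lameLead e).eval z ≠ 0 := by
      rw [eval_lameLead]
      exact Finset.prod_ne_zero_iff.mpr fun i _ => sub_ne_zero.mpr (hne i)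
    rw [← hTs.eval_derivative_div_eval_of_ne_zero hTz]
    field_simp
    apply mul_left_cancel₀ hAz
    linear_combination h

/-- If the nodes are real and the exponents positive, all zeros are real: at a zero whose
imaginary part is largest in absolute value every charge would pull away from the real axis, which
is incompatible with equilibrium. -/
theorem splits_of_ode [Nonempty ι] {e γ : ι → ℝ} (he : Function.Injective e)
    (hγ : ∀ i, 0 < γ i) {P V : ℝ[X]} (hP : P ≠ 0)
    (hode : lameLead e * derivative (derivative P) + lameSub e γ * derivative P + V * P = 0) :
    P.Splits := by
  set Q : ℂ[X] := P.map Complex.ofRealHom with hQ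
  have hQ0 : Q ≠ 0 := (Polynomial.map_ne_zero_iff Complex.ofRealHom.injective).mpr hP
  have hQs : Q.Splits := IsAlgClosed.splits Q
  refine Splits.of_splits_map Complex.ofRealHom hQs fun a ha => ?_
  have hodeQ : lameLead (fun i => (e i : ℂ)) * derivative (derivative Q)
      + lameSub (fun i => (e i : ℂ)) (fun i => (γ i : ℂ)) * derivative Q
      + V.map Complex.ofRealHom * Q = 0 := by
    have := congrArg (Polynomial.map Complex.ofRealHom) hode
    simpa [lameLead, lameSub, Polynomial.map_prod, Polynomial.map_sum, hQ,
      Polynomial.derivative_map] using this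
  have heC : Function.Injective fun i => (e i : ℂ) := fun i j h => he (Complex.ofReal_injective h)
  have hγC : ∀ i (k : ℕ), 1 ≤ k → (k : ℂ) - 1 + (γ i : ℂ) ≠ 0 := by
    intro i k hk h
    have h' : (k : ℝ) - 1 + γ i = 0 := by exact_mod_cast h
    have : (1 : ℝ) ≤ k := by exact_mod_cast hk
    linarith [hγ i]
  suffices h : ∀ b ∈ Q.roots, b.im = 0 from ⟨a.re, Complex.ext rfl (by simpa using (h a ha).symm)⟩
  obtain ⟨z, hz, hmax⟩ : ∃ z ∈ Q.roots.toFinset, ∀ w ∈ Q.roots.toFinset, |w.im| ≤ |z.im| :=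
    Finset.exists_max_image _ _ ⟨a, Multiset.mem_toFinset.mpr ha⟩
  -- if the extremal imaginary part vanishes, so do all others
  suffices hz0 : z.im = 0 by
    intro b hb
    simpa [hz0] using hmax b (Multiset.mem_toFinset.mpr hb)
  by_contra hz0
  obtain ⟨R, hR, -, heq⟩ := sum_inv_sub_roots_of_ode heC hγC hQ0 hQs hodeQ
    (Multiset.mem_toFinset.mp hz)
  -- multiplication by `z.im` treats zeros above and below the real axis alike
  have hinv : ∀ w : ℂ,
      z.im * (1 / (z - w)).im = -(z.im * (z.im - w.im)) / Complex.normSq (z - w) := fun w => by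
      rw [one_div, Complex.inv_im, Complex.sub_im]
      ring
  have h1 : z.im * ((R.map fun w => 1 / (z - w)).sum).im ≤ 0 := by
    have hle : ∀ w ∈ R, z.im * (1 / (z - w)).im ≤ 0 := by
      intro w hw
      have hw' : |w.im| ≤ |z.im| := hmax w (by
        rw [Multiset.mem_toFinset, hR]
        exact Multiset.mem_cons_of_mem hw)
      rw [hinv]
      refine div_nonpos_of_nonpos_of_nonneg ?_ (Complex.normSq_nonneg _)
      have : z.im * w.im ≤ |z.im| * |z.im| := calc
        z.im * w.im ≤ |z.im * w.im| := le_abs_self _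
        _ = |z.im| * |w.im| := abs_mul _ _
        _ ≤ _ := by gcongr
      rw [abs_mul_abs_self] at this
      linarith
    clear hR heq
    induction R using Multiset.induction with
    | empty => simp
    | cons w R ih =>
      rw [Multiset.map_cons, Multiset.sum_cons, Complex.add_im, mul_add]
      exact add_nonpos (hle w (Multiset.mem_cons_self w R))
        (ih fun w' hw' => hle w' (Multiset.mem_cons_of_mem hw'))
  have h2 : z.im * (∑ i, (γ i : ℂ) / (z - e i)).im < 0 := by
    rw [Complex.im_sum, Finset.mul_sum]
    refine Finset.sum_neg (fun i _ => ?_) Finset.univ_nonempty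
    have hne : z - e i ≠ 0 := fun h => hz0 (by simpa using congrArg Complex.im h)
    have : z.im * ((γ i : ℂ) / (z - e i)).im = γ i * (z.im * (1 / (z - e i)).im) := by
      rw [div_eq_mul_one_div, Complex.im_ofReal_mul]
      ring
    rw [this, hinv]
    refine mul_neg_of_pos_of_neg (hγ i) (div_neg_of_neg_of_pos ?_ (Complex.normSq_pos.mpr hne))
    have : 0 < z.im * z.im := mul_self_pos.mpr hz0
    simpa using this
  have h3 := congrArg (fun w : ℂ => z.im * w.im) heq
  simp only [Complex.add_im, Complex.zero_im, mul_zero, mul_add] at h3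
  have h4 : (2 * (R.map fun w => 1 / (z - w)).sum).im
      = 2 * ((R.map fun w => 1 / (z - w)).sum).im := by simp
  rw [h4] at h3
  linarith

end Polynomial

/-! ### Products of confocal quadratic forms -/

namespace MvPolynomial

variable {K ι : Type*} [Field K]

lemma _root_.Derivation.map_finset_prod {R A κ : Type*} [CommSemiring R] [CommSemiring A]
    [Algebra R A] [DecidableEq κ] (D : Derivation R A A) (s : Finset κ) (f : κ → A) :
    D (∏ z ∈ s, f z) = ∑ z ∈ s, (∏ w ∈ s.erase z, f w) * D (f z) := by
  induction s using Finset.induction_on with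
  | empty => simp
  | insert a s ha ih =>
    rw [Finset.prod_insert ha, D.leibniz, ih, Finset.sum_insert ha, Finset.erase_insert ha,
      smul_eq_mul, smul_eq_mul, Finset.mul_sum, add_comm]
    congr 1
    refine Finset.sum_congr rfl fun z hz => ?_
    have hza : a ≠ z := fun h => ha (h ▸ hz)
    rw [Finset.erase_insert_of_ne hza, Finset.prod_insert (fun h => ha (Finset.mem_of_mem_erase h)),
      mul_assoc]

lemma _root_.Finset.sum_sum_erase_comm {κ M : Type*} [DecidableEq κ] [AddCommMonoid M]
    (s : Finset κ) (F : κ → κ → M) :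
    ∑ z ∈ s, ∑ w ∈ s.erase z, F z w = ∑ z ∈ s, ∑ w ∈ s.erase z, F w z :=
  Finset.sum_comm' fun z w => by
    simp only [Finset.mem_erase]
    tauto

section parity

variable [DecidableEq ι] [Fintype ι] (μ : ι → ℕ)

lemma prod_X_pow_eq (i : ι) :
    ∃ Q : MvPolynomial ι K, (∏ j, X j ^ μ j) = X i ^ μ i * Q ∧ pderiv i Q = 0 := by
  refine ⟨∏ j ∈ Finset.univ.erase i, X j ^ μ j,
    (Finset.mul_prod_erase _ _ (Finset.mem_univ i)).symm, ?_⟩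
  rw [Derivation.map_finset_prod]
  refine Finset.sum_eq_zero fun j hj => ?_
  rw [Derivation.leibniz_pow, pderiv_X_of_ne (Finset.ne_of_mem_erase hj)]
  simp

lemma X_mul_pderiv_prod_X_pow (hμ : ∀ i, μ i ≤ 1) (i : ι) :
    X i * pderiv i (∏ j, X j ^ μ j : MvPolynomial ι K) = C (μ i : K) * ∏ j, X j ^ μ j := by
  obtain ⟨Q, hQ, hQ'⟩ := prod_X_pow_eq (K := K) μ i
  rw [hQ]
  rcases Nat.le_one_iff_eq_zero_or_eq_one.mp (hμ i) with h | h <;>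
    simp [h, Derivation.leibniz, hQ']

lemma pderiv_pderiv_prod_X_pow (hμ : ∀ i, μ i ≤ 1) (i : ι) :
    pderiv i (pderiv i (∏ j, X j ^ μ j : MvPolynomial ι K)) = 0 := by
  obtain ⟨Q, hQ, hQ'⟩ := prod_X_pow_eq (K := K) μ i
  rw [hQ]
  rcases Nat.le_one_iff_eq_zero_or_eq_one.mp (hμ i) with h | h <;>
    simp [h, Derivation.leibniz, hQ']

end parity

variable [Fintype ι]

/-- The quadratic form `∑ xᵢ² / (z - eᵢ)`, whose level sets are the confocal quadrics. -/
noncomputable def confocal (e : ι → K) (z : K) : MvPolynomial ι K :=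
  ∑ i, C (1 / (z - e i)) * X i ^ 2

lemma pderiv_confocal (e : ι → K) (z : K) (i : ι) :
    pderiv i (confocal e z) = C (2 / (z - e i)) * X i := by
  classical
  rw [confocal, map_sum, Finset.sum_eq_single i]
  · rw [pderiv_C_mul, Derivation.leibniz_pow, pderiv_X_self, nsmul_eq_mul, smul_eq_mul]
    have : C (2 / (z - e i)) = (2 : MvPolynomial ι K) * C (1 / (z - e i)) := by
      rw [← map_ofNat C 2, ← C_mul]
      congr 1
      ring
    rw [this]
    push_cast
    ring
  · intro j _ hj
    rw [pderiv_C_mul, Derivation.leibniz_pow, pderiv_X_of_ne hj]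
    simp
  · simp

/-- The partial fraction identity behind the harmonicity of products of confocal forms: the
gradients of two of them pair to a combination of the forms themselves. -/
lemma sum_pderiv_confocal_mul (e : ι → K) {z w : K} (hz : ∀ i, z ≠ e i) (hw : ∀ i, w ≠ e i)
    (hzw : z ≠ w) :
    ∑ i, pderiv i (confocal e w) * pderiv i (confocal e z)
      = C (4 / (z - w)) * (confocal e w - confocal e z) := by
  simp only [pderiv_confocal]
  simp only [confocal, ← Finset.sum_sub_distrib, Finset.mul_sum]
  refine Finset.sum_congr rfl fun i _ => ?_
  have h1 : z - e i ≠ 0 := sub_ne_zero.mpr (hz i)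
  have h2 : w - e i ≠ 0 := sub_ne_zero.mpr (hw i)
  have h3 : z - w ≠ 0 := sub_ne_zero.mpr hzw
  have : 2 / (w - e i) * (2 / (z - e i)) = 4 / (z - w) * (1 / (w - e i) - 1 / (z - e i)) := by
    field_simp
    ring
  calc _ = C (2 / (w - e i) * (2 / (z - e i))) * X i ^ 2 := by rw [C_mul]; ring
    _ = _ := by rw [this, C_mul, C_sub]; ring

variable [DecidableEq ι]

/-- Niven's theorem: the product of confocal forms at the points of `s`, times a square-free
monomial, is harmonic as soon as the points are in electrostatic equilibrium. -/
theorem sum_pderiv_pderiv_prod_confocal [CharZero K] [DecidableEq K] {e : ι → K} {μ : ι → ℕ}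
    (hμ : ∀ i, μ i ≤ 1) {s : Finset K} (hs : ∀ z ∈ s, ∀ i, z ≠ e i)
    (heq : ∀ z ∈ s, 2 * ∑ w ∈ s.erase z, 1 / (z - w) + ∑ i, (1 / 2 + μ i) / (z - e i) = 0) :
    ∑ i, pderiv i (pderiv i ((∏ j, X j ^ μ j) * ∏ z ∈ s, confocal e z)) = 0 := by
  set P : MvPolynomial ι K := ∏ j, X j ^ μ j with hP
  set H : K → MvPolynomial ι K := fun z => ∏ w ∈ s.erase z, confocal e w with hH
  have h1 : ∀ i, pderiv i (∏ z ∈ s, confocal e z) = ∑ z ∈ s, H z * pderiv i (confocal e z) :=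
    fun i => Derivation.map_finset_prod _ _ _
  have hcross : ∑ i, pderiv i P * pderiv i (∏ z ∈ s, confocal e z)
      = P * ∑ z ∈ s, H z * C (∑ i, 2 * μ i / (z - e i)) := by
    simp only [h1, pderiv_confocal, Finset.mul_sum, map_sum]
    rw [Finset.sum_comm]
    refine Finset.sum_congr rfl fun z _ => Finset.sum_congr rfl fun i _ => ?_
    have := X_mul_pderiv_prod_X_pow (K := K) μ hμ i
    rw [← hP] at this
    calc _ = C (2 / (z - e i)) * H z * (X i * pderiv i P) := by ring
      _ = (C (2 / (z - e i)) * C (μ i : K)) * (P * H z) := by rw [this]; ring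
      _ = _ := by
        rw [← C_mul, show 2 / (z - e i) * (μ i : K) = 2 * μ i / (z - e i) by ring]
        ring
  -- the Laplacian of the product of forms: mixed terms from pairs and pure second derivatives
  have hdiag : ∀ i z, pderiv i (H z * pderiv i (confocal e z))
      = (∑ w ∈ s.erase z, (∏ v ∈ (s.erase z).erase w, confocal e v)
          * (pderiv i (confocal e w) * pderiv i (confocal e z))) + H z * C (2 / (z - e i)) := by
    intro i z
    rw [Derivation.leibniz, hH, Derivation.map_finset_prod, smul_eq_mul, smul_eq_mul, add_comm]
    congr 1
    · rw [Finset.mul_sum]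
      refine Finset.sum_congr rfl fun w _ => ?_
      ring
    · rw [pderiv_confocal, pderiv_C_mul, pderiv_X_self, mul_one]
  have hlap : ∑ i, pderiv i (pderiv i (∏ z ∈ s, confocal e z))
      = ∑ z ∈ s, H z * C (8 * ∑ w ∈ s.erase z, 1 / (z - w) + ∑ i, 2 / (z - e i)) := by
    simp only [h1, map_sum, hdiag]
    rw [Finset.sum_comm]
    simp only [C_add, mul_add, Finset.sum_add_distrib]
    congr 1
    · calc _ = ∑ z ∈ s, ∑ w ∈ s.erase z, C (4 / (z - w)) * (H z - H w) := by
            refine Finset.sum_congr rfl fun z hz => ?_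
            rw [Finset.sum_comm]
            refine Finset.sum_congr rfl fun w hw => ?_
            have hws := Finset.mem_of_mem_erase hw
            have hwz := Finset.ne_of_mem_erase hw
            rw [← Finset.mul_sum, sum_pderiv_confocal_mul e (hs z hz) (hs w hws) hwz.symm]
            have e1 : H z = confocal e w * ∏ v ∈ (s.erase z).erase w, confocal e v :=
              (Finset.mul_prod_erase _ _ hw).symm
            have e2 : H w = confocal e z * ∏ v ∈ (s.erase z).erase w, confocal e v := by
              rw [Finset.erase_right_comm]
              exact (Finset.mul_prod_erase _ _ (Finset.mem_erase.mpr ⟨hwz.symm, hz⟩)).symm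
            rw [e1, e2]
            ring
        _ = ∑ z ∈ s, ∑ w ∈ s.erase z, C (4 / (z - w)) * H z
            - ∑ z ∈ s, ∑ w ∈ s.erase z, C (4 / (z - w)) * H w := by
            simp only [mul_sub, Finset.sum_sub_distrib]
        -- the roles of `z` and `w` are exchanged in the second sum, so that both contain `H z`
        _ = ∑ z ∈ s, ∑ w ∈ s.erase z, C (4 / (z - w)) * H z
            - ∑ z ∈ s, ∑ w ∈ s.erase z, C (4 / (w - z)) * H z := by
            rw [Finset.sum_sum_erase_comm s fun z w => C (4 / (z - w)) * H w]
        _ = _ := by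
            simp only [← Finset.sum_sub_distrib, Finset.mul_sum, map_sum]
            refine Finset.sum_congr rfl fun z hz => Finset.sum_congr rfl fun w hw => ?_
            rw [← sub_mul, ← C_sub, mul_comm]
            congr 2
            rw [← neg_sub z w, div_neg]
            ring
    · refine Finset.sum_congr rfl fun z _ => ?_
      rw [map_sum, Finset.mul_sum]
  calc _ = P * (∑ i, pderiv i (pderiv i (∏ z ∈ s, confocal e z)))
        + 2 * ∑ i, pderiv i P * pderiv i (∏ z ∈ s, confocal e z) := by
        rw [Finset.mul_sum, Finset.mul_sum, ← Finset.sum_add_distrib]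
        refine Finset.sum_congr rfl fun i _ => ?_
        have := pderiv_pderiv_prod_X_pow (K := K) μ hμ i
        rw [← hP] at this
        simp only [Derivation.leibniz, map_add, smul_eq_mul, this]
        ring
    _ = P * ∑ z ∈ s, H z * C (4 * (2 * ∑ w ∈ s.erase z, 1 / (z - w)
          + ∑ i, (1 / 2 + μ i) / (z - e i))) := by
        rw [hcross, hlap]
        simp only [Finset.mul_sum, ← Finset.sum_add_distrib]
        refine Finset.sum_congr rfl fun z _ => ?_
        have : (2 : MvPolynomial ι K) = C 2 := (map_ofNat C 2).symm
        rw [this, show ∀ b : K, C 2 * (P * (H z * C b)) = P * (H z * C (2 * b)) from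
          fun b => by rw [C_mul]; ring]
        rw [← mul_add, ← mul_add, ← C_add]
        congr 3
        simp only [← Finset.mul_sum]
        rw [show ∑ i, (1 / 2 + (μ i : K)) / (z - e i)
          = (∑ i, 2 / (z - e i)) / 4 + (∑ i, 2 * μ i / (z - e i)) / 2 by
            rw [Finset.sum_div, Finset.sum_div, ← Finset.sum_add_distrib]
            refine Finset.sum_congr rfl fun i _ => ?_
            ring]
        ring
    _ = 0 := by
        rw [Finset.sum_eq_zero, mul_zero]
        intro z hz
        rw [heq z hz]
        simp

end MvPolynomial

/-! ### Homogeneous harmonic polynomials on the sphere -/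

namespace S3Ellipsoidal

open MvPolynomial

/-- A polynomial divided by a power of the Euclidean norm. This class of functions is closed under
partial differentiation away from the origin. -/
noncomputable def normPowMul (k : ℕ) (q : MvPolynomial (Fin 4) ℝ)
    (y : EuclideanSpace ℝ (Fin 4)) : ℝ :=
  ‖y‖⁻¹ ^ k * eval (fun i => y i) q

lemma analyticAt_eval (q : MvPolynomial (Fin 4) ℝ) (y : EuclideanSpace ℝ (Fin 4)) :
    AnalyticAt ℝ (fun y : EuclideanSpace ℝ (Fin 4) => eval (fun i => y i) q) y :=
  (AnalyticOnNhd.eval_continuousLinearMap'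
    (fun i : Fin 4 => (EuclideanSpace.proj i : EuclideanSpace ℝ (Fin 4) →L[ℝ] ℝ)) q) y
      (Set.mem_univ y)

lemma differentiableAt_normPowMul (k : ℕ) (q : MvPolynomial (Fin 4) ℝ)
    {y : EuclideanSpace ℝ (Fin 4)} (hy : y ≠ 0) : DifferentiableAt ℝ (normPowMul k q) y :=
  (((differentiableAt_id.norm ℝ hy).inv (norm_ne_zero_iff.mpr hy)).pow k).mul
    (analyticAt_eval q y).differentiableAt

lemma hasDerivAt_eval_line (q : MvPolynomial (Fin 4) ℝ) (y : EuclideanSpace ℝ (Fin 4))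
    (i : Fin 4) :
    HasDerivAt (fun t : ℝ => eval (fun j => (y + t • EuclideanSpace.single i (1 : ℝ)) j) q)
      (eval (fun j => y j) (pderiv i q)) 0 := by
  induction q using MvPolynomial.induction_on with
  | C a => simpa using hasDerivAt_const (0 : ℝ) a
  | add p q hp hq => simpa only [map_add] using hp.fun_add hq
  | mul_X p j hp =>
    have hX : HasDerivAt (fun t : ℝ => (y + t • EuclideanSpace.single i (1 : ℝ)) j)
        (if j = i then 1 else 0) 0 := by
      have := ((hasDerivAt_id (0 : ℝ)).mul_const ((EuclideanSpace.single i (1 : ℝ)) j)).const_add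
        (y j)
      simpa [Pi.single_apply] using this
    have := hp.mul hX
    simp only [map_mul, MvPolynomial.eval_X]
    refine this.congr_deriv ?_
    rw [Derivation.leibniz]
    by_cases h : j = i
    · subst h
      simp
      ring
    · rw [pderiv_X_of_ne h]
      simp [h]
      ring

lemma fderiv_normPowMul (k : ℕ) (q : MvPolynomial (Fin 4) ℝ) {y : EuclideanSpace ℝ (Fin 4)}
    (hy : y ≠ 0) (i : Fin 4) :
    fderiv ℝ (normPowMul k q) y (EuclideanSpace.single i 1)
      = normPowMul k (pderiv i q) y - k * normPowMul (k + 2) (X i * q) y := by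
  rw [← (differentiableAt_normPowMul k q hy).lineDeriv_eq_fderiv]
  refine HasLineDerivAt.lineDeriv ?_
  have hN : HasDerivAt (fun t : ℝ => ‖y + t • EuclideanSpace.single i (1 : ℝ)‖)
      (y i / ‖y‖) 0 := by
    have h1 : HasDerivAt (fun t : ℝ => y + t • EuclideanSpace.single i (1 : ℝ))
        (EuclideanSpace.single i (1 : ℝ)) 0 := by
      simpa using ((hasDerivAt_id (0 : ℝ)).smul_const (EuclideanSpace.single i (1 : ℝ))).const_add y
    -- the norm is differentiated as the square root of its square
    have h2 := h1.norm_sq.sqrt (by simpa using hy)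
    simp only [Real.sqrt_sq (norm_nonneg _)] at h2
    refine h2.congr_deriv ?_
    simp [PiLp.inner_apply]
    field_simp
  have h0 : ‖y‖ ≠ 0 := norm_ne_zero_iff.mpr hy
  have h3 := ((hN.inv (by simpa using h0)).pow k).mul (hasDerivAt_eval_line q y i)
  unfold HasLineDerivAt normPowMul
  refine h3.congr_deriv ?_
  rcases k with _ | k
  · simp
  · simp
    field_simp
    ring

/-- The Laplacian of a homogeneous polynomial made constant along rays. -/
lemma laplacian_normPowMul {q : MvPolynomial (Fin 4) ℝ} {k : ℕ} (hq : q.IsHomogeneous k)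
    {x : EuclideanSpace ℝ (Fin 4)} (hx : ‖x‖ = 1) :
    Laplacian.laplacian (normPowMul k q) x
      = eval (fun i => x i) (∑ i, pderiv i (pderiv i q)) - k * (k + 2) * eval (fun i => x i) q := by
  have hx0 : x ≠ 0 := norm_ne_zero_iff.mp (by simp [hx])
  rw [InnerProductSpace.laplacian_eq_iteratedFDeriv_orthonormalBasis _
    (EuclideanSpace.basisFun (Fin 4) ℝ)]
  have hD : ∀ i, iteratedFDeriv ℝ 2 (normPowMul k q) x
        ![EuclideanSpace.basisFun (Fin 4) ℝ i, EuclideanSpace.basisFun (Fin 4) ℝ i]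
      = eval (fun i => x i) (pderiv i (pderiv i q))
        - 2 * k * (x i * eval (fun i => x i) (pderiv i q)) - k * eval (fun i => x i) q
        + k * (k + 2) * (x i ^ 2 * eval (fun i => x i) q) := by
    intro i
    rw [iteratedFDeriv_two_apply]
    simp only [Matrix.cons_val_zero, Matrix.cons_val_one, EuclideanSpace.basisFun_apply]
    have hev : (fun y => fderiv ℝ (normPowMul k q) y (EuclideanSpace.single i 1))
        =ᶠ[nhds x] fun y => normPowMul k (pderiv i q) y - k * normPowMul (k + 2) (X i * q) y :=
      Filter.Eventually.mono (isOpen_ne.mem_nhds hx0) fun y hy => fderiv_normPowMul k q hy i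
    have hC : ContDiffAt ℝ 2 (normPowMul k q) x :=
      (((contDiffAt_norm ℝ hx0).inv (norm_ne_zero_iff.mpr hx0)).pow k).mul
        (analyticAt_eval q x).contDiffAt
    have hdiff : DifferentiableAt ℝ (fderiv ℝ (normPowMul k q)) x :=
      (hC.fderiv_right (m := 1) (by norm_num)).differentiableAt (by norm_num)
    have h1 : fderiv ℝ (fderiv ℝ (normPowMul k q)) x (EuclideanSpace.single i 1)
          (EuclideanSpace.single i 1)
        = fderiv ℝ (fun y => fderiv ℝ (normPowMul k q) y (EuclideanSpace.single i 1)) x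
          (EuclideanSpace.single i 1) := by
      rw [fderiv_clm_apply hdiff (differentiableAt_const _)]
      simp
    rw [h1, hev.fderiv_eq, fderiv_fun_sub (differentiableAt_normPowMul _ _ hx0)
      ((differentiableAt_normPowMul _ _ hx0).const_mul _),
      fderiv_const_mul (differentiableAt_normPowMul _ _ hx0)]
    simp only [sub_apply, smul_apply,
      fderiv_normPowMul _ _ hx0, smul_eq_mul]
    simp [normPowMul, hx, Derivation.leibniz]
    ring
  have hsq : ∑ i, x i ^ 2 = 1 := by
    have := EuclideanSpace.real_norm_sq_eq x
    rw [hx] at this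
    simpa using this.symm
  have heuler : ∑ i, x i * eval (fun i => x i) (pderiv i q) = k * eval (fun i => x i) q := by
    have := congrArg (MvPolynomial.eval fun i => x i) hq.sum_X_mul_pderiv
    simpa using this
  simp only [hD, Finset.sum_add_distrib, Finset.sum_sub_distrib, ← Finset.mul_sum,
    ← Finset.sum_mul, hsq, heuler, map_sum]
  simp
  ring

lemma _root_.MvPolynomial.IsHomogeneous.eval_mul_left {R ι : Type*} [CommSemiring R] [Fintype ι]
    {q : MvPolynomial ι R} {k : ℕ} (hq : q.IsHomogeneous k) (r : R) (v : ι → R) :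
    eval (fun i => r * v i) q = r ^ k * eval v q := by
  rw [eval_eq', eval_eq', Finset.mul_sum]
  refine Finset.sum_congr rfl fun d hd => ?_
  have hdk : ∑ i, d i = k := by
    rw [← hq (mem_support_iff.mp hd), Finsupp.weight_apply, Finsupp.sum_fintype] <;> simp
  simp only [mul_pow, Finset.prod_mul_distrib, Finset.prod_pow_eq_pow_sum, hdk]
  ring

lemma radialExtension_restrictSphere {q : MvPolynomial (Fin 4) ℝ} {k : ℕ}
    (hq : q.IsHomogeneous k) {y : EuclideanSpace ℝ (Fin 4)} (hy : y ≠ 0) :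
    radialExtension (restrictSphere q) y = normPowMul k q y := by
  rw [radialExtension, dif_neg hy, restrictSphere, normPowMul]
  exact hq.eval_mul_left _ _

/-- The restriction to the sphere of a harmonic polynomial of degree `k` is an eigenfunction of
the Laplace–Beltrami operator with eigenvalue `-k (k + 2)`. -/
theorem laplaceBeltrami_restrictSphere {q : MvPolynomial (Fin 4) ℝ} {k : ℕ}
    (hq : q.IsHomogeneous k) (hharm : ∑ i, pderiv i (pderiv i q) = 0) (x : S3) :
    laplaceBeltrami (restrictSphere q) x = -(k * (k + 2)) * restrictSphere q x := by
  have hx : ‖(x : EuclideanSpace ℝ (Fin 4))‖ = 1 := norm_eq_of_mem_sphere x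
  have hx0 : (x : EuclideanSpace ℝ (Fin 4)) ≠ 0 := norm_ne_zero_iff.mp (by simp [hx])
  have hev : radialExtension (restrictSphere q) =ᶠ[nhds (x : EuclideanSpace ℝ (Fin 4))]
      normPowMul k q :=
    Filter.Eventually.mono (isOpen_ne.mem_nhds hx0) fun y hy => radialExtension_restrictSphere hq hy
  rw [laplaceBeltrami, (InnerProductSpace.laplacian_congr_nhds hev).eq_of_nhds,
    laplacian_normPowMul hq hx, hharm, restrictSphere]
  simp

/-- A nonzero homogeneous polynomial does not vanish identically on the sphere. -/
lemma restrictSphere_ne_zero {q : MvPolynomial (Fin 4) ℝ} {k : ℕ}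
    (hq : q.IsHomogeneous k) (h0 : q ≠ 0) : restrictSphere q ≠ 0 := by
  -- multiplication by a coordinate ensures that the point found is not the origin
  have h1 : X 0 * q ≠ 0 := mul_ne_zero (X_ne_zero 0) h0
  obtain ⟨v, hv⟩ : ∃ v : Fin 4 → ℝ, eval v (X 0 * q) ≠ 0 := by
    by_contra! h
    exact h1 (MvPolynomial.funext fun v => by simpa using h v)
  rw [map_mul, MvPolynomial.eval_X] at hv
  set y : EuclideanSpace ℝ (Fin 4) := WithLp.toLp 2 v with hy
  have hy0 : y ≠ 0 := fun h => left_ne_zero_of_mul hv (by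
    have := congrArg (fun w : EuclideanSpace ℝ (Fin 4) => w 0) h
    simpa [hy] using this)
  intro h
  have h2 := radialExtension_restrictSphere hq hy0
  rw [radialExtension, dif_neg hy0, h, normPowMul] at h2
  exact mul_ne_zero (pow_ne_zero k (inv_ne_zero (norm_ne_zero_iff.mpr hy0)))
    (right_ne_zero_of_mul hv) h2.symm

end S3Ellipsoidal

/-! ### Heine–Stieltjes polynomials -/

namespace S3Ellipsoidal


lemma gammaTilde_eq (μ : Fin 4 → Fin 2) (m : Fin 4) : gammaTilde μ m = 1 / 2 + (μ m : ℕ) := by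
  rw [gammaTilde]
  generalize μ m = a
  fin_cases a <;> norm_num

lemma gammaTilde_pos (μ : Fin 4 → Fin 2) (m : Fin 4) : 0 < gammaTilde μ m := by
  rw [gammaTilde_eq]
  positivity

lemma pairWeight_eq (μ : Fin 4 → Fin 2) (i j : Fin 4) :
    pairWeight μ i j = (μ i : ℕ) + (μ j : ℕ) + 2 * (μ i : ℕ) * (μ j : ℕ) := by
  rw [pairWeight]
  generalize μ i = a
  generalize μ j = b
  fin_cases a <;> fin_cases b <;> norm_num

lemma sum_pairs {M : Type*} [AddCommMonoid M] (F : Fin 4 → Fin 4 → M) :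
    ∑ i, ∑ j ∈ Finset.Ioi i, F i j
      = F 0 1 + F 0 2 + F 0 3 + (F 1 2 + F 1 3) + F 2 3 := by
  rw [Fin.sum_univ_four, show Finset.Ioi (0 : Fin 4) = {1, 2, 3} by decide,
    show Finset.Ioi (1 : Fin 4) = {2, 3} by decide, show Finset.Ioi (2 : Fin 4) = {3} by decide,
    show Finset.Ioi (3 : Fin 4) = ∅ by decide]
  simp [add_assoc]

lemma sq_fin_two (a : Fin 2) : ((a : ℕ) : ℝ) ^ 2 = (a : ℕ) := by
  fin_cases a <;> norm_num

lemma u0_eq (μ : Fin 4 → Fin 2) : u0 μ = (∑ i, (μ i : ℕ) : ℕ) * ((∑ i, (μ i : ℕ) : ℕ) + 2) := by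
  rw [u0, sum_pairs]
  simp only [pairWeight_eq, Fin.sum_univ_four]
  push_cast
  linear_combination -sq_fin_two (μ 0) - sq_fin_two (μ 1) - sq_fin_two (μ 2) - sq_fin_two (μ 3)

variable {e : Fin 4 → ℝ} {μ : Fin 4 → Fin 2} {d : ℕ} {E l₁ l₂ : ℝ} {S : ℝ[X]}

lemma IsHeineStieltjes.ne_zero (hS : IsHeineStieltjes e μ d E l₁ l₂ S) : S ≠ 0 := fun h => by
  simpa [h] using hS.degree_eq

lemma IsHeineStieltjes.natDegree_eq (hS : IsHeineStieltjes e μ d E l₁ l₂ S) : S.natDegree = d :=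
  natDegree_eq_of_degree_eq_some hS.degree_eq

/-- The equation with denominators cleared, as an identity between polynomials. -/
lemma IsHeineStieltjes.ode_poly (hS : IsHeineStieltjes e μ d E l₁ l₂ S) :
    lameLead e * derivative (derivative S) + lameSub e (gammaTilde μ) * derivative S
      + (C ((u0 μ - E) / 4) * X ^ 2 + C ((u1 e μ + l₁) / 4) * X + C ((u2 e μ - l₂) / 4)) * S
      = 0 := by
  refine eq_of_infinite_eval_eq _ _ ((Set.finite_range e).infinite_compl.mono fun z hz => ?_)
  have hz' : ∀ i, z ≠ e i := fun i h => hz ⟨i, h.symm⟩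
  have hA : (∏ m, (z - e m)) ≠ 0 :=
    Finset.prod_ne_zero_iff.mpr fun i _ => sub_ne_zero.mpr (hz' i)
  have h := hS.ode z hz'
  simp only [Set.mem_ofPred_eq, eval_add, eval_mul, eval_C, eval_X, eval_pow, eval_zero,
    eval_lameSub _ _ _ hz', eval_lameLead]
  field_simp at h
  linear_combination h / 4

/-- Comparing the coefficients of top degree in the equation determines the energy. -/
theorem IsHeineStieltjes.energy_eq (hS : IsHeineStieltjes e μ d E l₁ l₂ S) :
    E = ((2 * d + ∑ i, (μ i : ℕ) : ℕ) : ℝ) * ((2 * d + ∑ i, (μ i : ℕ) : ℕ) + 2) := by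
  have hd := hS.natDegree_eq
  have hc : S.coeff d ≠ 0 := by
    rw [← hd]
    exact leadingCoeff_ne_zero.mpr hS.ne_zero
  have hA : (lameLead e).natDegree = 4 ∧ (lameLead e).coeff 4 = 1 := by
    have h1 : (lameLead e).natDegree = 4 := by
      rw [lameLead, natDegree_prod_of_monic _ _ fun i _ => monic_X_sub_C _]
      simp
    refine ⟨h1, ?_⟩
    have h2 : (lameLead e).Monic := monic_prod_of_monic _ _ fun i _ => monic_X_sub_C _
    simpa [h1] using h2.coeff_natDegree
  have hB : (lameSub e (gammaTilde μ)).natDegree ≤ 3 ∧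
      (lameSub e (gammaTilde μ)).coeff 3 = ∑ i, gammaTilde μ i := by
    have h1 : ∀ i : Fin 4, (∏ l ∈ Finset.univ.erase i, (X - C (e l))).natDegree = 3 := by
      intro i
      rw [natDegree_prod_of_monic _ _ fun i _ => monic_X_sub_C _]
      simp
    have h2 : ∀ i : Fin 4, (∏ l ∈ Finset.univ.erase i, (X - C (e l))).Monic :=
      fun i => monic_prod_of_monic _ _ fun i _ => monic_X_sub_C _
    constructor
    · exact natDegree_sum_le_of_forall_le _ _ fun i _ =>
        (natDegree_C_mul_le _ _).trans (h1 i).le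
    · rw [lameSub, finsetSum_coeff]
      refine Finset.sum_congr rfl fun i _ => ?_
      have : (∏ l ∈ Finset.univ.erase i, (X - C (e l))).coeff 3 = 1 := by
        rw [← h1 i]
        exact h2 i
      rw [coeff_C_mul, this, mul_one]
  -- multiplication of the derivatives by powers of `X` avoids subtraction of degrees
  have hS1 : (X * derivative S).natDegree ≤ d ∧ (X * derivative S).coeff d = d * S.coeff d := by
    have hco : ∀ n, (X * derivative S).coeff n = n * S.coeff n := by
      rintro (_ | n)
      · simp
      · rw [coeff_X_mul, coeff_derivative]
        push_cast
        ring
    refine ⟨natDegree_le_iff_coeff_eq_zero.mpr fun n hn => ?_, hco d⟩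
    rw [hco, coeff_eq_zero_of_natDegree_lt (hd ▸ hn), mul_zero]
  have hS2 : (X ^ 2 * derivative (derivative S)).natDegree ≤ d ∧
      (X ^ 2 * derivative (derivative S)).coeff d = d * (d - 1) * S.coeff d := by
    have hco : ∀ n : ℕ, (X ^ 2 * derivative (derivative S)).coeff n
        = n * (n - 1) * S.coeff n := by
      rintro (_ | _ | n)
      · simp
      · simp [coeff_X_pow_mul']
      · rw [coeff_X_pow_mul, coeff_derivative, coeff_derivative]
        push_cast
        ring
    refine ⟨natDegree_le_iff_coeff_eq_zero.mpr fun n hn => ?_, hco d⟩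
    rw [hco, coeff_eq_zero_of_natDegree_lt (hd ▸ hn), mul_zero]
  set V : ℝ[X] := C ((u0 μ - E) / 4) * X ^ 2 + C ((u1 e μ + l₁) / 4) * X + C ((u2 e μ - l₂) / 4)
    with hV
  have hV1 : (X ^ 2 * V).natDegree ≤ 4 := by
    refine natDegree_mul_le.trans ?_
    rw [natDegree_X_pow]
    have : V.natDegree ≤ 2 := natDegree_quadratic_le
    omega
  have hV2 : (X ^ 2 * V).coeff 4 = (u0 μ - E) / 4 := by
    rw [show (4 : ℕ) = 2 + 2 from rfl, coeff_X_pow_mul, hV]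
    simp
  have hB1 : (X * lameSub e (gammaTilde μ)).natDegree ≤ 4 := by
    refine natDegree_mul_le.trans ?_
    rw [natDegree_X]
    omega
  have hB2 : (X * lameSub e (gammaTilde μ)).coeff 4 = ∑ i, gammaTilde μ i := by
    rw [coeff_X_mul, hB.2]
  have key : lameLead e * (X ^ 2 * derivative (derivative S))
      + (X * lameSub e (gammaTilde μ)) * (X * derivative S) + (X ^ 2 * V) * S = 0 := by
    linear_combination X ^ 2 * hS.ode_poly
  have h := congrArg (fun p => p.coeff (4 + d)) key
  simp only [coeff_add, coeff_zero] at h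
  rw [coeff_mul_add_eq_of_natDegree_le hA.1.le hS2.1, coeff_mul_add_eq_of_natDegree_le hB1 hS1.1,
    coeff_mul_add_eq_of_natDegree_le hV1 hd.le, hA.2, hS2.2, hB2, hS1.2, hV2, u0_eq] at h
  simp only [gammaTilde_eq, Fin.sum_univ_four] at h ⊢
  push_cast at h ⊢
  apply mul_left_cancel₀ hc
  linear_combination -4 * h

theorem IsHeineStieltjes.splits (hS : IsHeineStieltjes e μ d E l₁ l₂ S) (he : StrictMono e) :
    S.Splits :=
  splits_of_ode he.injective (gammaTilde_pos μ) hS.ne_zero hS.ode_poly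

/-- The zeros of a Heine–Stieltjes polynomial are simple, and satisfy Niven's equations. -/
theorem IsHeineStieltjes.roots_spec (hS : IsHeineStieltjes e μ d E l₁ l₂ S) (he : StrictMono e) :
    S.roots.Nodup ∧ (∀ z ∈ S.roots, ∀ i, z ≠ e i) ∧
      ∀ z ∈ S.roots.toFinset, 2 * ∑ w ∈ S.roots.toFinset.erase z, 1 / (z - w)
        + ∑ i, (1 / 2 + (μ i : ℕ)) / (z - e i) = 0 := by
  have hγ : ∀ i (k : ℕ), 1 ≤ k → (k : ℝ) - 1 + gammaTilde μ i ≠ 0 := by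
    intro i k hk
    have : (1 : ℝ) ≤ k := by exact_mod_cast hk
    have := gammaTilde_pos μ i
    exact ne_of_gt (by linarith)
  have hR := fun z (hz : z ∈ S.roots) =>
    sum_inv_sub_roots_of_ode he.injective hγ hS.ne_zero (hS.splits he) hS.ode_poly hz
  have hnd : S.roots.Nodup := by
    rw [Multiset.nodup_iff_count_eq_one]
    intro z hz
    obtain ⟨R, h, hzR, -⟩ := hR z hz
    rw [h, Multiset.count_cons_self, Multiset.count_eq_zero_of_notMem hzR]
  refine ⟨hnd, fun z hz => (exists_cofactor_of_ode he.injective hγ hS.ne_zero hS.ode_poly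
    (isRoot_of_mem_roots hz)).1, fun z hz => ?_⟩
  obtain ⟨R, h, hzR, heq⟩ := hR z (Multiset.mem_toFinset.mp hz)
  have hval : (S.roots.toFinset.erase z).val = R := by
    rw [Finset.erase_val, Multiset.toFinset_val, hnd.dedup, h, Multiset.erase_cons_head]
  simp only [gammaTilde_eq] at heq
  rw [Finset.sum, hval]
  exact heq

/-! ### The wave functions -/

lemma quadForm_isHomogeneous (e : Fin 4 → ℝ) (z : ℝ) : (quadForm e z).IsHomogeneous 2 :=
  MvPolynomial.IsHomogeneous.sum _ _ _ fun i _ => MvPolynomial.isHomogeneous_C_mul_X_pow _ i 2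

lemma quadForm_eq_confocal (e : Fin 4 → ℝ) {z : ℝ} (hz : ∀ i, z ≠ e i) :
    quadForm e z = MvPolynomial.C (∏ i, (z - e i)) * MvPolynomial.confocal e z := by
  rw [quadForm, MvPolynomial.confocal, Finset.mul_sum]
  refine Finset.sum_congr rfl fun i _ => ?_
  have : z - e i ≠ 0 := sub_ne_zero.mpr (hz i)
  rw [← mul_assoc, ← MvPolynomial.C_mul, ← Finset.mul_prod_erase _ _ (Finset.mem_univ i)]
  congr 2
  field_simp

lemma quadForm_ne_zero (e : Fin 4 → ℝ) {z : ℝ} (hz : ∀ i, z ≠ e i) : quadForm e z ≠ 0 := by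
  intro h
  have h1 := congrArg (MvPolynomial.eval (Pi.single 0 1)) h
  simp only [quadForm, map_sum, map_mul, map_pow, MvPolynomial.eval_C, MvPolynomial.eval_X,
    map_zero] at h1
  rw [Finset.sum_eq_single 0 (fun i _ hi => by simp [hi]) (by simp)] at h1
  simp only [Pi.single_eq_same, one_pow, mul_one] at h1
  exact Finset.prod_ne_zero_iff.mpr (fun i _ => sub_ne_zero.mpr (hz i)) h1

lemma Phi_isHomogeneous (hS : S.Splits) : (Phi e S).IsHomogeneous (2 * S.natDegree) := by
  refine MvPolynomial.IsHomogeneous.C_mul ?_ _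
  rw [hS.natDegree_eq_card_roots]
  induction S.roots using Multiset.induction with
  | empty => simpa using MvPolynomial.isHomogeneous_one _ _
  | cons z R ih =>
    rw [Multiset.map_cons, Multiset.prod_cons, Multiset.card_cons, mul_add, add_comm]
    exact (quadForm_isHomogeneous e z).mul ih

lemma Psi_isHomogeneous (μ : Fin 4 → Fin 2) (hS : S.Splits) :
    (Psi e μ S).IsHomogeneous (2 * S.natDegree + ∑ i, (μ i : ℕ)) := by
  rw [add_comm]
  exact (MvPolynomial.IsHomogeneous.prod _ _ _ fun i _ =>
    MvPolynomial.isHomogeneous_X_pow i _).mul (Phi_isHomogeneous hS)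

lemma Psi_ne_zero (μ : Fin 4 → Fin 2) (hS : S ≠ 0) (hroots : ∀ z ∈ S.roots, ∀ i, z ≠ e i) :
    Psi e μ S ≠ 0 := by
  refine mul_ne_zero
    (Finset.prod_ne_zero_iff.mpr fun i _ => pow_ne_zero _ (MvPolynomial.X_ne_zero i)) (mul_ne_zero ?_ ?_)
  · have : S.leadingCoeff ≠ 0 := leadingCoeff_ne_zero.mpr hS
    exact (map_ne_zero_iff _ (MvPolynomial.C_injective _ _)).mpr (by simp [this])
  · refine Multiset.prod_ne_zero fun h => ?_
    obtain ⟨z, hz, h0⟩ := Multiset.mem_map.mp h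
    exact quadForm_ne_zero e (hroots z hz) h0

theorem IsHeineStieltjes.harmonic (hS : IsHeineStieltjes e μ d E l₁ l₂ S) (he : StrictMono e) :
    ∑ i, MvPolynomial.pderiv i (MvPolynomial.pderiv i (Psi e μ S)) = 0 := by
  obtain ⟨hnd, hne, heq⟩ := hS.roots_spec he
  have hPsi : ∃ c : ℝ, Psi e μ S = MvPolynomial.C c * ((∏ j, MvPolynomial.X j ^ (μ j : ℕ))
      * ∏ z ∈ S.roots.toFinset, MvPolynomial.confocal e z) := by
    have h1 : (S.roots.map (quadForm e)).prod = ∏ z ∈ S.roots.toFinset, quadForm e z := by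
      rw [Finset.prod, Multiset.toFinset_val, hnd.dedup]
    refine ⟨(-1) ^ S.natDegree * S.leadingCoeff ^ 3
      * ∏ z ∈ S.roots.toFinset, ∏ i, (z - e i), ?_⟩
    rw [Psi, Phi, h1, Finset.prod_congr rfl fun z hz =>
      quadForm_eq_confocal e (hne z (Multiset.mem_toFinset.mp hz)), Finset.prod_mul_distrib,
      ← map_prod, MvPolynomial.C_mul (a := (-1) ^ S.natDegree * S.leadingCoeff ^ 3)]
    ring
  obtain ⟨c, hc⟩ := hPsi
  simp only [hc, MvPolynomial.pderiv_C_mul, ← Finset.mul_sum]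
  rw [MvPolynomial.sum_pderiv_pderiv_prod_confocal (fun i => Nat.le_of_lt_succ (μ i).2)
    (fun z hz => hne z (Multiset.mem_toFinset.mp hz)) heq, mul_zero]

/-! ### Ellipsoidal coordinates -/

/-- In ellipsoidal coordinates the quadratic form is a product: both sides are polynomials of
degree less than four in `z`, and they agree at the four nodes. -/
lemma eval_quadForm (he : Function.Injective e) {s : Fin 3 → ℝ} {x : Fin 4 → ℝ}
    (hx : ∀ i, x i ^ 2 = cartesianSq e s i) (z : ℝ) :
    MvPolynomial.eval x (quadForm e z) = ∏ j, (z - s j) := by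
  set f : ℝ[X] := ∑ i, C (x i ^ 2) * ∏ k ∈ Finset.univ.erase i, (X - C (e k)) with hf
  set g : ℝ[X] := ∏ j, (X - C (s j)) with hg
  have hfg : f = g := by
    refine Polynomial.eq_of_degrees_lt_of_eval_index_eq Finset.univ he.injOn ?_ ?_ ?_
    · refine lt_of_le_of_lt (degree_le_natDegree.trans (Nat.cast_le.mpr
        (natDegree_sum_le_of_forall_le (n := 3) _ _ fun i _ =>
          (natDegree_C_mul_le _ _).trans ?_))) (by simp; norm_num)
      rw [natDegree_prod_of_monic _ _ fun i _ => monic_X_sub_C _]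
      simp
    · rw [hg, degree_prod]
      simp
      norm_num
    · intro i _
      rw [hf, hg, eval_finsetSum, eval_prod, Finset.sum_eq_single i]
      · rw [eval_C_mul, hx, cartesianSq, eval_prod]
        simp only [eval_sub, eval_X, eval_C]
        have hden : ∏ k ∈ Finset.univ.erase i, (e k - e i) ≠ 0 :=
          Finset.prod_ne_zero_iff.mpr fun k hk =>
            sub_ne_zero.mpr fun h => Finset.ne_of_mem_erase hk (he h)
        have h1 : ∏ k ∈ Finset.univ.erase i, (e i - e k)
            = (-1) ^ 3 * ∏ k ∈ Finset.univ.erase i, (e k - e i) := by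
          rw [show (3 : ℕ) = (Finset.univ.erase i).card by simp, ← Finset.prod_const,
            ← Finset.prod_mul_distrib]
          exact Finset.prod_congr rfl fun k _ => by ring
        have h2 : ∏ j, (e i - s j) = (-1) ^ 3 * ∏ j, (s j - e i) := by
          simp only [Fin.prod_univ_three]
          ring
        rw [h1, h2]
        field_simp
      · intro k _ hk
        rw [eval_C_mul, eval_prod, Finset.prod_eq_zero (Finset.mem_erase.mpr
          ⟨hk.symm, Finset.mem_univ i⟩) (by simp), mul_zero]
      · simp
  have h := congrArg (Polynomial.eval z) hfg
  rw [hf, hg, eval_finsetSum, eval_prod] at h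
  simp only [eval_C_mul, eval_prod, eval_sub, eval_X, eval_C] at h
  rw [← h, quadForm, map_sum]
  refine Finset.sum_congr rfl fun i _ => ?_
  simp [mul_comm]

/-- Each zero `z` contributes `∏ⱼ (z - sⱼ) = -∏ⱼ (sⱼ - z)`; the sign in the definition of `Phi`
compensates. -/
lemma eval_Phi (he : Function.Injective e) (hS : S.Splits) {s : Fin 3 → ℝ} {x : Fin 4 → ℝ}
    (hx : ∀ i, x i ^ 2 = cartesianSq e s i) :
    MvPolynomial.eval x (Phi e S) = ∏ j, S.eval (s j) := by
  have h1 : ∀ R : Multiset ℝ, MvPolynomial.eval x (R.map (quadForm e)).prod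
      = (-1) ^ R.card * ∏ j, (R.map fun z => s j - z).prod := by
    intro R
    induction R using Multiset.induction with
    | empty => simp
    | cons z R ih =>
      simp only [Multiset.map_cons, Multiset.prod_cons, Multiset.card_cons, map_mul, ih,
        eval_quadForm he hx, Finset.prod_mul_distrib, pow_succ]
      simp only [Fin.prod_univ_three]
      ring
  rw [Phi, map_mul, MvPolynomial.eval_C, h1, ← hS.natDegree_eq_card_roots]
  simp only [hS.eval_eq_prod_roots, Finset.prod_mul_distrib, Finset.prod_const]
  have h2 : ((-1 : ℝ) ^ S.natDegree) * (-1) ^ S.natDegree = 1 := by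
    rw [← mul_pow]
    simp
  simp only [Finset.card_univ, Fintype.card_fin]
  linear_combination (S.leadingCoeff ^ 3 * ∏ j, (S.roots.map fun z => s j - z).prod) * h2

end S3Ellipsoidal

/-! ### Logarithmic derivatives -/

/-- `f` has at `x` the derivative `f x * L`; where `f x ≠ 0` this says that `L` is the logarithmic
derivative of `f` at `x`. -/
def HasLogDerivAt (f : ℝ → ℝ) (L x : ℝ) : Prop := HasDerivAt f (f x * L) x

namespace HasLogDerivAt

variable {f g : ℝ → ℝ} {L M x : ℝ}

lemma const (c x : ℝ) : HasLogDerivAt (fun _ => c) 0 x := by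
  simpa [HasLogDerivAt] using hasDerivAt_const x c

lemma sub_const (a : ℝ) (h : x ≠ a) : HasLogDerivAt (fun t => t - a) (1 / (x - a)) x := by
  have : x - a ≠ 0 := sub_ne_zero.mpr h
  exact ((hasDerivAt_id x).sub_const a).congr_deriv (by field_simp)

lemma const_sub (a : ℝ) (h : x ≠ a) : HasLogDerivAt (fun t => a - t) (1 / (x - a)) x := by
  have : x - a ≠ 0 := sub_ne_zero.mpr h
  exact ((hasDerivAt_id x).const_sub a).congr_deriv (by field_simp; ring)

lemma mul (hf : HasLogDerivAt f L x) (hg : HasLogDerivAt g M x) :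
    HasLogDerivAt (fun t => f t * g t) (L + M) x :=
  (HasDerivAt.mul hf hg).congr_deriv (by ring)

lemma inv (hf : HasLogDerivAt f L x) (h0 : f x ≠ 0) : HasLogDerivAt (fun t => (f t)⁻¹) (-L) x :=
  (HasDerivAt.inv hf h0).congr_deriv (by field_simp)

lemma div (hf : HasLogDerivAt f L x) (hg : HasLogDerivAt g M x) (h0 : g x ≠ 0) :
    HasLogDerivAt (fun t => f t / g t) (L - M) x := by
  simpa only [div_eq_mul_inv, sub_eq_add_neg] using hf.mul (hg.inv h0)

lemma neg (hf : HasLogDerivAt f L x) : HasLogDerivAt (fun t => -f t) L x :=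
  (HasDerivAt.neg hf).congr_deriv (by ring)

lemma pow (hf : HasLogDerivAt f L x) (n : ℕ) : HasLogDerivAt (fun t => f t ^ n) (n * L) x := by
  induction n with
  | zero => simpa using HasLogDerivAt.const 1 x
  | succ n ih =>
    simp only [pow_succ]
    convert! ih.mul hf using 1
    push_cast
    ring

lemma prod {ι : Type*} {s : Finset ι} {f : ι → ℝ → ℝ} {L : ι → ℝ}
    (h : ∀ i ∈ s, HasLogDerivAt (f i) (L i) x) :
    HasLogDerivAt (fun t => ∏ i ∈ s, f i t) (∑ i ∈ s, L i) x := by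
  classical
  induction s using Finset.induction_on with
  | empty => simpa using HasLogDerivAt.const 1 x
  | insert a s ha ih =>
    simp only [Finset.prod_insert ha, Finset.sum_insert ha]
    exact (h a (Finset.mem_insert_self a s)).mul
      (ih fun i hi => h i (Finset.mem_insert_of_mem hi))

lemma sqrt (hf : HasLogDerivAt f L x) (h0 : 0 < f x) :
    HasLogDerivAt (fun t => √(f t)) (L / 2) x := by
  refine (HasDerivAt.sqrt hf h0.ne').congr_deriv ?_
  have h1 : √(f x) ≠ 0 := (Real.sqrt_pos.mpr h0).ne'
  field_simp
  rw [Real.sq_sqrt h0.le, mul_comm]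

end HasLogDerivAt

/-! ### Separation of variables in ellipsoidal coordinates -/

namespace S3Ellipsoidal

variable {e : Fin 4 → ℝ} {s : Fin 3 → ℝ}

/-- The open box of ellipsoidal coordinates. -/
def InBox (e : Fin 4 → ℝ) (s : Fin 3 → ℝ) : Prop :=
  ∀ j : Fin 3, e j.castSucc < s j ∧ s j < e j.succ

lemma InBox.lt_of_castSucc_lt (h : InBox e s) (he : StrictMono e) {j : Fin 3} {i : Fin 4}
    (hij : j.castSucc < i) : s j < e i :=
  (h j).2.trans_le (he.monotone (Fin.castSucc_lt_iff_succ_le.mp hij))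

lemma InBox.lt_of_le_castSucc (h : InBox e s) (he : StrictMono e) {j : Fin 3} {i : Fin 4}
    (hij : i ≤ j.castSucc) : e i < s j :=
  (he.monotone hij).trans_lt (h j).1

lemma InBox.ne (h : InBox e s) (he : StrictMono e) (j : Fin 3) (i : Fin 4) : s j ≠ e i := by
  rcases lt_or_ge j.castSucc i with hij | hij
  · exact (h.lt_of_castSucc_lt he hij).ne
  · exact (h.lt_of_le_castSucc he hij).ne'

lemma InBox.strictMono (h : InBox e s) : StrictMono s := by
  rw [Fin.strictMono_iff_lt_succ]
  intro i
  refine (h i.castSucc).2.trans ?_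
  exact (h i.succ).1

lemma InBox.update (h : InBox e s) (j : Fin 3) {t : ℝ} (ht : e j.castSucc < t ∧ t < e j.succ) :
    InBox e (Function.update s j t) := by
  intro k
  rcases eq_or_ne k j with rfl | hk
  · simpa using ht
  · simpa [hk] using h k

/-- Each factor `sⱼ - eᵢ` of the numerator has the sign of one factor `eₖ - eᵢ` of the
denominator. -/
lemma InBox.cartesianSq_pos (h : InBox e s) (he : StrictMono e) (i : Fin 4) :
    0 < cartesianSq e s i := by
  have hden : ∏ k ∈ Finset.univ.erase i, (e k - e i)
      = ∏ j : Fin 3, (e (i.succAbove j) - e i) := by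
    have : (Finset.univ.erase i) = Finset.univ.map i.succAboveEmb := by
      ext k
      simp [Fin.exists_succAbove_eq_iff]
    rw [this, Finset.prod_map]
    rfl
  rw [cartesianSq, hden, ← Finset.prod_div_distrib]
  refine Finset.prod_pos fun j _ => ?_
  rcases lt_or_ge j.castSucc i with hij | hij
  · rw [Fin.succAbove_of_castSucc_lt _ _ hij]
    exact div_pos_of_neg_of_neg (sub_neg.mpr (h.lt_of_castSucc_lt he hij)) (sub_neg.mpr (he hij))
  · rw [Fin.succAbove_of_le_castSucc _ _ hij]
    exact div_pos (sub_pos.mpr (h.lt_of_le_castSucc he hij))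
      (sub_pos.mpr (he (hij.trans_lt (Fin.castSucc_lt_succ))))

lemma univ_erase_three : (Finset.univ.erase 0 : Finset (Fin 3)) = {1, 2} ∧
    (Finset.univ.erase 1 : Finset (Fin 3)) = {0, 2} ∧
    (Finset.univ.erase 2 : Finset (Fin 3)) = {0, 1} := by decide

/-- The metric is definite in the box: an odd number of the factors in numerator and denominator
together are negative, which cancels the sign in front. -/
lemma InBox.metric_pos (h : InBox e s) (he : StrictMono e) (j : Fin 3) : 0 < metric e j s := by
  have h01 : 0 < s 1 - s 0 := sub_pos.mpr (h.strictMono (by decide))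
  have h02 : 0 < s 2 - s 0 := sub_pos.mpr (h.strictMono (by decide))
  have h12 : 0 < s 2 - s 1 := sub_pos.mpr (h.strictMono (by decide))
  have hpos : ∀ (j : Fin 3) (i : Fin 4), i ≤ j.castSucc → 0 < s j - e i := fun j i hij =>
    sub_pos.mpr (h.lt_of_le_castSucc he hij)
  have hneg : ∀ (j : Fin 3) (i : Fin 4), j.castSucc < i → 0 < e i - s j := fun j i hij =>
    sub_pos.mpr (h.lt_of_castSucc_lt he hij)
  obtain ⟨u0, u1, u2⟩ := univ_erase_three
  rw [metric, Fin.prod_univ_four]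
  fin_cases j
  · have a0 := hpos 0 0 (by decide)
    have a1 := hneg 0 1 (by decide)
    have a2 := hneg 0 2 (by decide)
    have a3 := hneg 0 3 (by decide)
    simp only [Fin.zero_eta, u0]
    rw [Finset.prod_pair (by decide), show -((s 0 - s 1) * (s 0 - s 2)) / (4 * ((s 0 - e 0)
      * (s 0 - e 1) * (s 0 - e 2) * (s 0 - e 3))) = ((s 1 - s 0) * (s 2 - s 0)) / (4 * ((s 0 - e 0)
      * (e 1 - s 0) * (e 2 - s 0) * (e 3 - s 0))) by
        rw [neg_div, ← div_neg]
        congr 1 <;> ring]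
    positivity
  · have a0 := hpos 1 0 (by decide)
    have a1 := hpos 1 1 (by decide)
    have a2 := hneg 1 2 (by decide)
    have a3 := hneg 1 3 (by decide)
    simp only [Fin.mk_one, u1]
    rw [Finset.prod_pair (by decide), show -((s 1 - s 0) * (s 1 - s 2)) / (4 * ((s 1 - e 0)
      * (s 1 - e 1) * (s 1 - e 2) * (s 1 - e 3))) = ((s 1 - s 0) * (s 2 - s 1)) / (4 * ((s 1 - e 0)
      * (s 1 - e 1) * (e 2 - s 1) * (e 3 - s 1))) by
        congr 1 <;> ring]
    positivity
  · have a0 := hpos 2 0 (by decide)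
    have a1 := hpos 2 1 (by decide)
    have a2 := hpos 2 2 (by decide)
    have a3 := hneg 2 3 (by decide)
    simp only [Fin.reduceFinMk, u2]
    rw [Finset.prod_pair (by decide), show -((s 2 - s 0) * (s 2 - s 1)) / (4 * ((s 2 - e 0)
      * (s 2 - e 1) * (s 2 - e 2) * (s 2 - e 3))) = ((s 2 - s 0) * (s 2 - s 1)) / (4 * ((s 2 - e 0)
      * (s 2 - e 1) * (s 2 - e 2) * (e 3 - s 2))) by
        rw [neg_div, ← div_neg]
        congr 1
        ring]
    positivity

lemma InBox.ellipsoidalPoint_sq (h : InBox e s) (he : StrictMono e) (ε : Fin 4 → ℤˣ) (i : Fin 4) :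
    ellipsoidalPoint e ε s i ^ 2 = cartesianSq e s i := by
  rw [ellipsoidalPoint, mul_pow, Real.sq_sqrt (h.cartesianSq_pos he i).le]
  rcases Int.units_eq_one_or (ε i) with h | h <;> simp [h]

lemma hasLogDerivAt_ellipsoidalPoint (h : InBox e s) (he : StrictMono e) (ε : Fin 4 → ℤˣ)
    (j : Fin 3) (i : Fin 4) :
    HasLogDerivAt (fun t => ellipsoidalPoint e ε (Function.update s j t) i)
      (1 / (s j - e i) / 2) (s j) := by
  -- `xᵢ²` is an affine function of `sⱼ` that vanishes at `eᵢ`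
  have hc : ∀ t, cartesianSq e (Function.update s j t) i
      = (t - e i) * ((∏ k ∈ Finset.univ.erase j, (s k - e i))
        / ∏ k ∈ Finset.univ.erase i, (e k - e i)) := by
    intro t
    rw [cartesianSq, ← Finset.mul_prod_erase _ _ (Finset.mem_univ j), mul_div_assoc]
    congr 2
    · simp
    · refine Finset.prod_congr rfl fun k hk => ?_
      rw [Function.update_of_ne (Finset.ne_of_mem_erase hk)]
  have h1 := (HasLogDerivAt.sub_const (e i) (h.ne he j i)).mul (HasLogDerivAt.const
    ((∏ k ∈ Finset.univ.erase j, (s k - e i)) / ∏ k ∈ Finset.univ.erase i, (e k - e i)) (s j))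
  simp only [← hc, add_zero] at h1
  have h2 := (HasLogDerivAt.const ((ε i : ℤ) : ℝ) (s j)).mul
    (h1.sqrt (by simpa using h.cartesianSq_pos he i))
  simpa only [ellipsoidalPoint, zero_add] using h2

/-- The factor `√g / gⱼⱼ` has, as a function of `sⱼ`, the same logarithmic derivative as the square
root of `∏ (sⱼ - eᵢ)`. -/
lemma hasLogDerivAt_weight (h : InBox e s) (he : StrictMono e) (j : Fin 3) :
    HasLogDerivAt (fun t => √(∏ k, metric e k (Function.update s j t))
        * (metric e j (Function.update s j t))⁻¹)
      ((∑ i, 1 / (s j - e i)) / 2) (s j) := by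
  have hu : Function.update s j (s j) = s := Function.update_eq_self j s
  have hD : ∀ k l : Fin 3, k ≠ l → HasLogDerivAt
      (fun t => Function.update s j t k - Function.update s j t l)
      (if k = j then 1 / (s j - s l) else if l = j then 1 / (s j - s k) else 0) (s j) := by
    intro k l hkl
    by_cases hk : k = j
    · subst hk
      simpa [hkl.symm] using HasLogDerivAt.sub_const (s l) (h.strictMono.injective.ne hkl)
    · by_cases hl : l = j
      · subst hl
        simpa [hk] using HasLogDerivAt.const_sub (s k) (h.strictMono.injective.ne hkl.symm)
      · simpa [hk, hl] using HasLogDerivAt.const (s k - s l) (s j)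
  have hI : ∀ (k : Fin 3) (i : Fin 4), HasLogDerivAt (fun t => Function.update s j t k - e i)
      (if k = j then 1 / (s j - e i) else 0) (s j) := by
    intro k i
    by_cases hk : k = j
    · subst hk
      simpa using HasLogDerivAt.sub_const (e i) (h.ne he k i)
    · simpa [hk] using HasLogDerivAt.const (s k - e i) (s j)
  have hM : ∀ k, HasLogDerivAt (fun t => metric e k (Function.update s j t))
      ((∑ l ∈ Finset.univ.erase k,
        (if k = j then 1 / (s j - s l) else if l = j then 1 / (s j - s k) else 0))
        - ∑ i, (if k = j then 1 / (s j - e i) else 0)) (s j) := by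
    intro k
    have h1 := (HasLogDerivAt.prod (s := Finset.univ.erase k) fun l hl =>
      hD k l (Finset.ne_of_mem_erase hl).symm).neg.div
        ((HasLogDerivAt.const 4 (s j)).mul (HasLogDerivAt.prod (s := Finset.univ) fun i _ => hI k i))
        (by
          rw [hu]
          exact mul_ne_zero four_ne_zero (Finset.prod_ne_zero_iff.mpr fun i _ =>
            sub_ne_zero.mpr (h.ne he k i)))
    simpa only [metric, zero_add] using h1
  have h2 := ((HasLogDerivAt.prod (s := Finset.univ) fun k _ => hM k).sqrt (by
    rw [hu]
    exact Finset.prod_pos fun k _ => h.metric_pos he k)).mul ((hM j).inv (by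
      rw [hu]
      exact (h.metric_pos he j).ne'))
  convert! h2 using 1
  obtain ⟨u0, u1, u2⟩ := univ_erase_three
  fin_cases j <;> simp [Fin.sum_univ_three, u0, u1, u2] <;> ring

lemma eval_Psi_of_inBox (h : InBox e s) (he : StrictMono e) (μ : Fin 4 → Fin 2) {S : ℝ[X]}
    (hS : S.Splits) (ε : Fin 4 → ℤˣ) :
    MvPolynomial.eval (ellipsoidalPoint e ε s) (Psi e μ S)
      = (∏ i, ellipsoidalPoint e ε s i ^ (μ i : ℕ)) * ∏ j, S.eval (s j) := by
  rw [Psi, map_mul, eval_Phi he.injective hS (h.ellipsoidalPoint_sq he ε)]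
  simp

end S3Ellipsoidal

/-! ### The Laplace–Beltrami operator in ellipsoidal coordinates -/

namespace S3Ellipsoidal

variable {e : Fin 4 → ℝ} {μ : Fin 4 → Fin 2} {d : ℕ} {E l₁ l₂ : ℝ} {S : ℝ[X]} {s : Fin 3 → ℝ}

/-- The logarithmic derivative of the factor `∏ |z - eᵢ| ^ (μᵢ / 2)`, which turns the equation for
`S` into one that does not depend on the symmetry class. -/
noncomputable def logDerivFactor (e : Fin 4 → ℝ) (μ : Fin 4 → Fin 2) (z : ℝ) : ℝ :=
  ∑ i, (μ i : ℕ) * (1 / (z - e i) / 2)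

lemma compl_pairs :
    ({0, 1}ᶜ : Finset (Fin 4)) = {2, 3} ∧ ({0, 2}ᶜ : Finset (Fin 4)) = {1, 3} ∧
    ({0, 3}ᶜ : Finset (Fin 4)) = {1, 2} ∧ ({1, 2}ᶜ : Finset (Fin 4)) = {0, 3} ∧
    ({1, 3}ᶜ : Finset (Fin 4)) = {0, 2} ∧ ({2, 3}ᶜ : Finset (Fin 4)) = {0, 1} := by decide

/-- The partial fraction expansion of the shift of the coefficient of `S`. -/
lemma shift_eq (μ : Fin 4 → Fin 2) {z : ℝ} (hz : ∀ i, z ≠ e i) :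
    (u0 μ * z ^ 2 + u1 e μ * z + u2 e μ) / (4 * ∏ m, (z - e m))
      = (∑ i, ∑ j ∈ Finset.Ioi i,
          pairWeight μ i j * (1 / (z - e i)) * (1 / (z - e j))) / 4 := by
  obtain ⟨c01, c02, c03, c12, c13, c23⟩ := compl_pairs
  have h0 := sub_ne_zero.mpr (hz 0)
  have h1 := sub_ne_zero.mpr (hz 1)
  have h2 := sub_ne_zero.mpr (hz 2)
  have h3 := sub_ne_zero.mpr (hz 3)
  simp only [u0, u1, u2, sum_pairs, c01, c02, c03, c12, c13, c23, Fin.prod_univ_four]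
  rw [Finset.sum_pair (by decide), Finset.sum_pair (by decide), Finset.sum_pair (by decide),
    Finset.sum_pair (by decide), Finset.sum_pair (by decide), Finset.sum_pair (by decide),
    Finset.prod_pair (by decide), Finset.prod_pair (by decide), Finset.prod_pair (by decide),
    Finset.prod_pair (by decide), Finset.prod_pair (by decide), Finset.prod_pair (by decide)]
  field_simp
  ring

/-- The transformed equation for `S` is the Lamé equation for the product of `S` with
`∏ |z - eᵢ| ^ (μᵢ / 2)`, divided by the latter factor and by the leading coefficient. -/
lemma IsHeineStieltjes.ode_separated (hS : IsHeineStieltjes e μ d E l₁ l₂ S) {z : ℝ}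
    (hz : ∀ i, z ≠ e i) :
    (logDerivFactor e μ z + (∑ i, 1 / (z - e i)) / 2)
        * (logDerivFactor e μ z * S.eval z + (derivative S).eval z)
      + ((∑ i, (μ i : ℕ) * (-(1 / (z - e i)) ^ 2 / 2)) * S.eval z
        + logDerivFactor e μ z * (derivative S).eval z + (derivative (derivative S)).eval z)
      = -((-E * z ^ 2 + l₁ * z - l₂) / (4 * ∏ m, (z - e m))) * S.eval z := by
  have h := hS.ode z hz
  have h1 : ((u0 μ - E) * z ^ 2 + (u1 e μ + l₁) * z + (u2 e μ - l₂)) / (4 * ∏ m, (z - e m))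
      = (∑ i, ∑ j ∈ Finset.Ioi i,
          pairWeight μ i j * (1 / (z - e i)) * (1 / (z - e j))) / 4
        + (-E * z ^ 2 + l₁ * z - l₂) / (4 * ∏ m, (z - e m)) := by
    rw [← shift_eq μ hz]
    ring
  have h2 : ∀ m, gammaTilde μ m / (z - e m) = (1 / 2 + (μ m : ℕ)) * (1 / (z - e m)) := fun m => by
    rw [gammaTilde_eq]
    ring
  rw [h1] at h
  simp only [h2] at h
  rw [logDerivFactor]
  simp only [sum_pairs] at h
  simp only [pairWeight_eq, Fin.sum_univ_four] at h ⊢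
  generalize (-E * z ^ 2 + l₁ * z - l₂) / (4 * ∏ m, (z - e m)) = v at h ⊢
  generalize 1 / (z - e 0) = a0 at h ⊢
  generalize 1 / (z - e 1) = a1 at h ⊢
  generalize 1 / (z - e 2) = a2 at h ⊢
  generalize 1 / (z - e 3) = a3 at h ⊢
  -- `μᵢ² = μᵢ` makes the double poles cancel
  linear_combination h + (S.eval z / 4) * (a0 ^ 2 * sq_fin_two (μ 0) + a1 ^ 2 * sq_fin_two (μ 1)
    + a2 ^ 2 * sq_fin_two (μ 2) + a3 ^ 2 * sq_fin_two (μ 3))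

/-- The wave function in ellipsoidal coordinates without its polynomial factor in `sⱼ`. -/
noncomputable def cofactor (e : Fin 4 → ℝ) (μ : Fin 4 → Fin 2) (S : ℝ[X]) (ε : Fin 4 → ℤˣ)
    (j : Fin 3) (s : Fin 3 → ℝ) : ℝ :=
  (∏ i, ellipsoidalPoint e ε s i ^ (μ i : ℕ)) * ∏ k ∈ Finset.univ.erase j, S.eval (s k)

lemma InBox.eventually_update (h : InBox e s) (j : Fin 3) :
    ∀ᶠ t in nhds (s j), InBox e (Function.update s j t) := by
  filter_upwards [lt_mem_nhds (h j).1, gt_mem_nhds (h j).2] with t h1 h2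
  exact h.update j ⟨h1, h2⟩

lemma hasLogDerivAt_cofactor (h : InBox e s) (he : StrictMono e) (μ : Fin 4 → Fin 2) (S : ℝ[X])
    (ε : Fin 4 → ℤˣ) (j : Fin 3) :
    HasLogDerivAt (fun t => cofactor e μ S ε j (Function.update s j t))
      (logDerivFactor e μ (s j)) (s j) := by
  have h1 := (HasLogDerivAt.prod (s := Finset.univ) fun i _ =>
    (hasLogDerivAt_ellipsoidalPoint h he ε j i).pow (μ i : ℕ)).mul
      (HasLogDerivAt.const (∏ k ∈ Finset.univ.erase j, S.eval (s k)) (s j))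
  rw [add_zero] at h1
  convert! h1 using 3 with t
  rw [cofactor]
  congr 1
  refine Finset.prod_congr rfl fun k hk => ?_
  rw [Function.update_of_ne (Finset.ne_of_mem_erase hk)]

lemma eval_Psi_eq_cofactor_mul (h : InBox e s) (he : StrictMono e) (hS : S.Splits)
    (ε : Fin 4 → ℤˣ) (j : Fin 3) :
    MvPolynomial.eval (ellipsoidalPoint e ε s) (Psi e μ S)
      = cofactor e μ S ε j s * S.eval (s j) := by
  rw [eval_Psi_of_inBox h he μ hS, cofactor, ← Finset.mul_prod_erase _ _ (Finset.mem_univ j)]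
  ring

lemma partialDeriv_Psi (h : InBox e s) (he : StrictMono e) (hS : S.Splits) (ε : Fin 4 → ℤˣ)
    (j : Fin 3) :
    partialDeriv j (fun t => MvPolynomial.eval (ellipsoidalPoint e ε t) (Psi e μ S)) s
      = cofactor e μ S ε j s * (logDerivFactor e μ (s j) * S.eval (s j)
        + (derivative S).eval (s j)) := by
  have hev : (fun t => MvPolynomial.eval (ellipsoidalPoint e ε (Function.update s j t))
        (Psi e μ S))
      =ᶠ[nhds (s j)] fun t => cofactor e μ S ε j (Function.update s j t) * S.eval t := by
    filter_upwards [h.eventually_update j] with t ht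
    simpa using eval_Psi_eq_cofactor_mul (μ := μ) ht he hS ε j
  rw [partialDeriv, hev.deriv_eq]
  have h1 : HasDerivAt _ _ _ := hasLogDerivAt_cofactor h he μ S ε j
  refine ((h1.mul (S.hasDerivAt (s j))).congr_deriv ?_).deriv
  simp only [Function.update_eq_self]
  ring

/-- One summand of the Laplace–Beltrami operator: the weight `√g / gⱼⱼ` combines with the
separated equation so that only the spectral polynomial survives. -/
lemma partialDeriv_weight_mul_partialDeriv (h : InBox e s) (he : StrictMono e)
    (hS : IsHeineStieltjes e μ d E l₁ l₂ S) (ε : Fin 4 → ℤˣ) (j : Fin 3) :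
    partialDeriv j (fun t => √(∏ k, metric e k t) * (metric e j t)⁻¹
        * partialDeriv j (fun t => MvPolynomial.eval (ellipsoidalPoint e ε t) (Psi e μ S)) t) s
      = √(∏ k, metric e k s) * (metric e j s)⁻¹
        * (-((-E * s j ^ 2 + l₁ * s j - l₂) / (4 * ∏ m, (s j - e m))))
        * MvPolynomial.eval (ellipsoidalPoint e ε s) (Psi e μ S) := by
  have hu : Function.update s j (s j) = s := Function.update_eq_self j s
  have hev : (fun t => √(∏ k, metric e k (Function.update s j t))
        * (metric e j (Function.update s j t))⁻¹
        * partialDeriv j (fun t => MvPolynomial.eval (ellipsoidalPoint e ε t) (Psi e μ S))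
          (Function.update s j t))
      =ᶠ[nhds (s j)] fun t => √(∏ k, metric e k (Function.update s j t))
        * (metric e j (Function.update s j t))⁻¹ * cofactor e μ S ε j (Function.update s j t)
        * (logDerivFactor e μ t * S.eval t + (derivative S).eval t) := by
    filter_upwards [h.eventually_update j] with t ht
    rw [partialDeriv_Psi ht he (hS.splits he) ε j, Function.update_self]
    ring
  have hL : HasDerivAt (logDerivFactor e μ)
      (∑ i, ((μ i : ℕ) : ℝ) * (-(1 / (s j - e i)) ^ 2 / 2)) (s j) := by
    unfold logDerivFactor
    refine HasDerivAt.fun_sum fun i _ => ?_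
    have h0 : s j - e i ≠ 0 := sub_ne_zero.mpr (h.ne he j i)
    have h1 := ((((hasDerivAt_id (s j)).sub_const (e i)).inv h0).div_const 2).const_mul
      (((μ i : ℕ)) : ℝ)
    simp only [one_div]
    refine h1.congr_deriv ?_
    simp only [id]
    field_simp
  have hW : HasDerivAt _ _ _ :=
    (hasLogDerivAt_weight h he j).mul (hasLogDerivAt_cofactor h he μ S ε j)
  rw [partialDeriv, hev.deriv_eq, (hW.fun_mul ((hL.fun_mul (S.hasDerivAt (s j))).fun_add
    ((derivative S).hasDerivAt (s j)))).deriv, eval_Psi_eq_cofactor_mul h he (hS.splits he) ε j]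
  simp only [hu]
  have := hS.ode_separated (h.ne he j)
  linear_combination √(∏ k, metric e k s) * (metric e j s)⁻¹ * cofactor e μ S ε j s * this

/-- The leading divided difference: only the quadratic coefficient of the spectral polynomial
survives the summation over the three coordinates. -/
lemma sum_inv_metric_mul (h : InBox e s) (he : StrictMono e) (E l₁ l₂ : ℝ) :
    ∑ j, (metric e j s)⁻¹ * (-((-E * s j ^ 2 + l₁ * s j - l₂) / (4 * ∏ m, (s j - e m)))) = -E := by
  have h1 : ∀ j, (metric e j s)⁻¹
        * (-((-E * s j ^ 2 + l₁ * s j - l₂) / (4 * ∏ m, (s j - e m))))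
      = (-E * s j ^ 2 + l₁ * s j - l₂) / ∏ k ∈ Finset.univ.erase j, (s j - s k) := by
    intro j
    have hA : ∏ m, (s j - e m) ≠ 0 :=
      Finset.prod_ne_zero_iff.mpr fun i _ => sub_ne_zero.mpr (h.ne he j i)
    have hB : ∏ k ∈ Finset.univ.erase j, (s j - s k) ≠ 0 :=
      Finset.prod_ne_zero_iff.mpr fun k hk => sub_ne_zero.mpr
        (h.strictMono.injective.ne (Finset.ne_of_mem_erase hk).symm)
    rw [metric]
    field_simp
  obtain ⟨u0, u1, u2⟩ := univ_erase_three
  simp only [h1, Fin.sum_univ_three, u0, u1, u2]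
  rw [Finset.prod_pair (by decide), Finset.prod_pair (by decide), Finset.prod_pair (by decide)]
  have h01 : s 0 - s 1 ≠ 0 := sub_ne_zero.mpr (h.strictMono (by decide)).ne
  have h02 : s 0 - s 2 ≠ 0 := sub_ne_zero.mpr (h.strictMono (by decide)).ne
  have h12 : s 1 - s 2 ≠ 0 := sub_ne_zero.mpr (h.strictMono (by decide)).ne
  rw [← neg_sub (s 0) (s 1), ← neg_sub (s 0) (s 2), ← neg_sub (s 1) (s 2)]
  field_simp
  ring

theorem laplaceBeltramiCoord_Psi (h : InBox e s) (he : StrictMono e)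
    (hS : IsHeineStieltjes e μ d E l₁ l₂ S) (ε : Fin 4 → ℤˣ) :
    laplaceBeltramiCoord e
        (fun t => MvPolynomial.eval (ellipsoidalPoint e ε t) (Psi e μ S)) s
      = -E * MvPolynomial.eval (ellipsoidalPoint e ε s) (Psi e μ S) := by
  have hg : √(∏ k, metric e k s) ≠ 0 :=
    (Real.sqrt_pos.mpr (Finset.prod_pos fun k _ => h.metric_pos he k)).ne'
  rw [laplaceBeltramiCoord]
  simp only [partialDeriv_weight_mul_partialDeriv h he hS]
  rw [Finset.mul_sum]
  refine Eq.trans ?_ (congrArg (· * MvPolynomial.eval (ellipsoidalPoint e ε s) (Psi e μ S))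
    (sum_inv_metric_mul h he E l₁ l₂))
  simp only [Finset.sum_mul]
  refine Finset.sum_congr rfl fun j _ => ?_
  field_simp

end S3Ellipsoidal

theorem mainTheorem1 (e : Fin 4 → ℝ) (he : StrictMono e) (μ : Fin 4 → Fin 2) (d D : ℕ)
    (hD : D = 2 * d + ∑ i, (μ i : ℕ)) (E l₁ l₂ : ℝ) (S : Polynomial ℝ)
    (hS : S3Ellipsoidal.IsHeineStieltjes e μ d E l₁ l₂ S) :
    -- `Φ` is the product of the three values of `S`, rewritten in Cartesian coordinates
    (S3Ellipsoidal.Phi e S).IsHomogeneous (2 * d) ∧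
    (∀ (s : Fin 3 → ℝ) (x : Fin 4 → ℝ), S3Ellipsoidal.IsEllipsoidalCoord e s x →
      MvPolynomial.eval x (S3Ellipsoidal.Phi e S) = ∏ j, S.eval (s j)) ∧
    -- `Ψ` is a harmonic polynomial of degree `D`
    (S3Ellipsoidal.Psi e μ S).IsHomogeneous D ∧
    (∑ i, MvPolynomial.pderiv i (MvPolynomial.pderiv i (S3Ellipsoidal.Psi e μ S)) = 0) ∧
    -- the spherical harmonic is a nonzero eigenfunction with energy `E = D (D + 2)`
    S3Ellipsoidal.restrictSphere (S3Ellipsoidal.Psi e μ S) ≠ 0 ∧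
    (∀ (ℏ : ℝ) (x : S3Ellipsoidal.S3),
      S3Ellipsoidal.schrodinger ℏ (S3Ellipsoidal.restrictSphere (S3Ellipsoidal.Psi e μ S)) x
        = ℏ ^ 2 * E * S3Ellipsoidal.restrictSphere (S3Ellipsoidal.Psi e μ S) x) ∧
    E = D * (D + 2) ∧
    -- the same eigenvalue equation written in ellipsoidal coordinates
    (∀ (ℏ : ℝ) (ε : Fin 4 → ℤˣ) (s : Fin 3 → ℝ),
      (∀ j : Fin 3, e j.castSucc < s j ∧ s j < e j.succ) →
      -ℏ ^ 2 * S3Ellipsoidal.laplaceBeltramiCoord e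
          (fun t => MvPolynomial.eval (S3Ellipsoidal.ellipsoidalPoint e ε t)
            (S3Ellipsoidal.Psi e μ S)) s
        = ℏ ^ 2 * E * MvPolynomial.eval (S3Ellipsoidal.ellipsoidalPoint e ε s)
            (S3Ellipsoidal.Psi e μ S)) := by
  have hsp := hS.splits he
  have hd := hS.natDegree_eq
  have hPhi := S3Ellipsoidal.Phi_isHomogeneous (e := e) hsp
  have hPsi := S3Ellipsoidal.Psi_isHomogeneous (e := e) μ hsp
  have hE := hS.energy_eq
  rw [hd] at hPhi hPsi
  rw [← hD] at hPsi hE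
  refine ⟨hPhi, fun s x hx => S3Ellipsoidal.eval_Phi he.injective hsp hx.2, hPsi, hS.harmonic he,
    S3Ellipsoidal.restrictSphere_ne_zero hPsi
      (S3Ellipsoidal.Psi_ne_zero μ hS.ne_zero (hS.roots_spec he).2.1), fun ℏ x => ?_, hE,
    fun ℏ ε s hs => ?_⟩
  · rw [S3Ellipsoidal.schrodinger,
      S3Ellipsoidal.laplaceBeltrami_restrictSphere hPsi (hS.harmonic he), hE]
    ring
  · rw [S3Ellipsoidal.laplaceBeltramiCoord_Psi hs he hS]
    ring
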